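/- Let $\alpha>-1/2$, and let $G_n=G_n^{(\alpha)}$ be the Gegenbauer polynomials normalized by $G_0=1$, $G_1(x)=x$, $(n+2\alpha)G_{n+1}(x)=2(n+\alpha)xG_n(x)-nG_{n-1}(x)$ for $n\ge 1$. Let $K_n$ be the leading coefficient of $G_n$, and let $\lambda_n=\int_{-1}^1 G_n(x)^2(1-x^2)^{\alpha-1/2}\,dx=\dfrac{2^{2\alpha-1}\,n!\,\Gamma(\alpha+\frac12)^2}{(n+\alpha)\Gamma(n+2\alpha)}$ (for $n=0$, $\lambda_0=2^{2\alpha}\Gamma(\alpha+\frac12)^2/\Gamma(2\alpha+1)$). Let $q_n=G_{n+1}-G_n$, and let $1=x_{n,0}>x_{n,1}>\dots>x_{n,n}$ be its zeros. Put $$\aleph_{n,j}=2^{2\alpha-1}\frac{\Gamma(\alpha+\frac12)^2\,n!}{(n+\alpha+\frac12)\,\Gamma(n+2\alpha+1)}\,\frac{1+x_{n,j}}{G_n(x_{n,j})^{2}},\qquad \varpi_{n,0}=(\alpha+\tfrac12)\aleph_{n,0},\quad \varpi_{n,j}=\aleph_{n,j}\ (1\le j\le n),$$ $$Q^{(1)}_{i,k}=\sum_{j=0}^n\lambda_j^{-1}\,\varpi_{n,k}\,G_j(x_{n,k})\int_{-1}^{x_{n,i}}G_j(x)\,dx\qquad(0\le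 i,k\le n).$$ For $b>0$ put $x_{b,n,i}=\frac b2(x_{n,i}+1)$, $Q_b^{(1)}=\frac b2Q^{(1)}$, $q_{b,n}(x)=q_n(2x/b-1)$, $K_{b,n}=(2/b)^nK_n$, and write $\|g\|_{\infty,[0,b]}=\sup_{[0,b]}|g|$. For $f\in C^{n+1}[0,b]$ and $0\le i\le n$ let $$E_{b,n,i}(f)=\int_0^{x_{b,n,i}}f(x)\,dx-\sum_{k=0}^nQ^{(1)}_{b,i,k}\,f(x_{b,n,k})$$ be the truncation error of the shifted Gegenbauer quadrature, and for $\xi\in(0,b)$ let $$E_{b,n,i}(f;\xi)=\frac{f^{(n+1)}(\xi)}{(n+1)!\,K_{b,n+1}}\int_0^{x_{b,n,i}}q_{b,n}(x)\,dx .$$ (a) For all $n\ge 0$, $b>0$, $f\in C^{n+1}[0,b]$ with $A=\|f^{(n+1)}\|_{\infty,[0,b]}$, all $i=0,\dots,n$ and all $\xi\in(0,b)$, both $|E_{b,n,i}(f)|$ and $|E_{b,n,i}(f;\xi)|$ are at most $$\frac{2^{-2n-1}\,A\,b^{n+1}\,x_{b,n,i}\,\Gamma(n+2\alpha+1)\,\Gamma(\alpha+1)}{(n+1)!\,\Gamma(n+\alpha+1)\,\Gamma(2\alpha+1)}\,\|q_{b,n}\|_{\infty,[0,b]}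 .$$ (b) If $\alpha\ge 0$, there are a constant $B>0$ and an integer $N$, both depending only on $\alpha$, such that for all $n\ge N$ and all $b,f,A,i,\xi$ as in (a), both quantities are at most $$B\,A\,b^{n+1}\left(\frac e4\right)^n\frac{x_{b,n,i}}{n^{\,n+3/2-\alpha}} .$$ (c) If $-1/2<\alpha<0$, there are a constant $C>0$ and an integer $N$, both depending only on $\alpha$, such that for all $n\ge N$ and all $b,f,A,i,\xi$ as in (a), both quantities are at most $$C\,A\,2^{-2n-1}e^n\,n^{-n-3/2}\,x_{b,n,i}\,b^{n+1} .$$ -/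

import Mathlib

open Polynomial

noncomputable section

namespace GegenbauerRadau

/-- The Gegenbauer polynomial of degree `n` with parameter `α`, standardized by the value `1` at
the point `1`: `(n + 2α) G (n+1) = 2 (n + α) x G n - n G (n-1)` for `n ≥ 1`. -/
def gegenbauer (α : ℝ) : ℕ → ℝ[X]
  | 0 => 1
  | 1 => X
  | n + 2 =>
      C (1 / ((n : ℝ) + 1 + 2 * α)) *
        (C (2 * ((n : ℝ) + 1 + α)) * X * gegenbauer α (n + 1) - C ((n : ℝ) + 1) * gegenbauer α n)

/-- The leading coefficient `K_n` of the Gegenbauer polynomial of degree `n`. -/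
def leadCoeff (α : ℝ) (n : ℕ) : ℝ := (gegenbauer α n).leadingCoeff

/-- The leading coefficient `K_{b,n} = (2/b)^n K_n` of the shifted Gegenbauer polynomial
`x ↦ G_n (2x/b - 1)`. -/
def shiftedLeadCoeff (α b : ℝ) (n : ℕ) : ℝ := (2 / b) ^ n * leadCoeff α n

/-- The squared norm of the Gegenbauer polynomial of degree `n` with respect to the weight
`(1 - x²)^(α - 1/2)` on `[-1, 1]`:
`2^(2α-1) n! Γ(α+1/2)² / ((n+α) Γ(n+2α))`. For `n = 0` the denominator `α Γ(2α)` is written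
as `Γ(2α+1)/2`, which also covers the removable singularity at `α = 0`. -/
def normSq (α : ℝ) (n : ℕ) : ℝ :=
  if n = 0 then (2 : ℝ) ^ (2 * α) * Real.Gamma (α + 1 / 2) ^ 2 / Real.Gamma (2 * α + 1)
  else (2 : ℝ) ^ (2 * α - 1) * (n.factorial : ℝ) * Real.Gamma (α + 1 / 2) ^ 2 /
    (((n : ℝ) + α) * Real.Gamma ((n : ℝ) + 2 * α))

/-- The polynomial `q_n = G_{n+1} - G_n` of degree `n + 1`. -/
def radauPoly (α : ℝ) (n : ℕ) : ℝ[X] := gegenbauer α (n + 1) - gegenbauer α n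

/-- The shifted function `q_{b,n}(x) = q_n (2x/b - 1)`. -/
def shiftedRadau (α b : ℝ) (n : ℕ) (x : ℝ) : ℝ := (radauPoly α n).eval (2 * x / b - 1)

/-- The flipped Gegenbauer-Gauss-Radau nodes `x_{n,0} > x_{n,1} > ... > x_{n,n}`: the real zeros
of `q_n`, listed in descending order. -/
def node (α : ℝ) (n k : ℕ) : ℝ := ((radauPoly α n).roots.sort (· ≥ ·)).getD k 0

/-- The shifted nodes `x_{b,n,k} = (b/2) (x_{n,k} + 1)` in `[0, b]`. -/
def shiftedNode (α b : ℝ) (n k : ℕ) : ℝ := b / 2 * (node α n k + 1)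

/-- The common expression for the Christoffel numbers, before the correction at the node `1`. -/
def preWeight (α : ℝ) (n j : ℕ) : ℝ :=
  (2 : ℝ) ^ (2 * α - 1) *
    (Real.Gamma (α + 1 / 2) ^ 2 * (n.factorial : ℝ) /
      (((n : ℝ) + α + 1 / 2) * Real.Gamma ((n : ℝ) + 2 * α + 1))) *
    (1 + node α n j) * (((gegenbauer α n).eval (node α n j)) ^ 2)⁻¹

/-- The Christoffel numbers of the flipped Gegenbauer-Gauss-Radau quadrature on `[-1, 1]`. -/
def weight (α : ℝ) (n j : ℕ) : ℝ :=
  if j = 0 then (α + 1 / 2) * preWeight α n 0 else preWeight α n j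

/-- The first-order Gegenbauer integration matrix `Q^(1)` at the nodes. -/
def intMatrix (α : ℝ) (n : ℕ) : Matrix (Fin (n + 1)) (Fin (n + 1)) ℝ :=
  Matrix.of fun i k =>
    ∑ j ∈ Finset.range (n + 1),
      (normSq α j)⁻¹ * weight α n k * (gegenbauer α j).eval (node α n k) *
        ∫ x in (-1 : ℝ)..(node α n i), (gegenbauer α j).eval x

/-- The first-order shifted Gegenbauer integration matrix `Q_b^(1) = (b/2) Q^(1)`. -/
def shiftedIntMatrix (α b : ℝ) (n : ℕ) : Matrix (Fin (n + 1)) (Fin (n + 1)) ℝ :=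
  (b / 2) • intMatrix α n

/-- The truncation error of the shifted Gegenbauer quadrature for `f` on `[0, x_{b,n,i}]`:
the integral of `f` minus its quadrature approximation. -/
def truncError (α b : ℝ) (n : ℕ) (f : ℝ → ℝ) (i : Fin (n + 1)) : ℝ :=
  (∫ x in (0 : ℝ)..(shiftedNode α b n i), f x) -
    ∑ k : Fin (n + 1), shiftedIntMatrix α b n i k * f (shiftedNode α b n k)

/-- The error term
`f^(n+1)(ξ) / ((n+1)! K_{b,n+1}) * ∫_0^{x_{b,n,i}} q_{b,n}` in derivative form. -/
def errorTerm (α b : ℝ) (n : ℕ) (f : ℝ → ℝ) (i : Fin (n + 1)) (ξ : ℝ) : ℝ :=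
  iteratedDerivWithin (n + 1) f (Set.Icc 0 b) ξ /
      (((n + 1).factorial : ℝ) * shiftedLeadCoeff α b (n + 1)) *
    ∫ x in (0 : ℝ)..(shiftedNode α b n i), shiftedRadau α b n x

/-- The sup norm of `g` on the set `S`. -/
def supNormOn (g : ℝ → ℝ) (S : Set ℝ) : ℝ := sSup ((fun x => |g x|) '' S)

end GegenbauerRadau

end

noncomputable section

namespace GegenbauerRadau

variable {α : ℝ}

/-! ### Algebra of the Gegenbauer polynomials -/

/-! The quadrature sum is the exact integral of the polynomial interpolating `f` at the shifted
zeros of `q_n`, so its error is an interpolation error. This rests on the Christoffel-Darboux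
formula: at a zero `y` of `q_n`, where `G_{n+1}(y) = G_n(y)`, it makes the kernel `∑ λ_j⁻¹ G_j(y)
G_j` a multiple of `q_n / (X - y)`, a Lagrange basis polynomial up to scale. The weight is the
reciprocal of the kernel on the diagonal, so it supplies the right scale
(`weight_mul_eval_kernelPoly`). The formula is proved over any commutative `ℝ`-algebra: over `ℂ` it
shows that the zeros are real, over `ℝ[X]` it identifies the kernel. Orthogonality is never used;
the `λ_j` enter only through scalar recurrences.

Repeated use of Rolle's theorem bounds `|f - P|` pointwise by `A |q_{b,n}| / ((n+1)! K_{b,n+1})`.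
Integrating this, and inserting `K_{n+1}` in closed form, gives (a); the term with `ξ` obeys the
same bound directly, for every `ξ`.

For (b) and (c), the Gamma quotient is `O(n^α)`, Stirling handles `(n+1)!`, and `q_n` is bounded
through the Sonin function, whose derivative on `[0, 1]` has the sign of `α`. For `α ≥ 0` its
maximum is at `1`, so `|G_n| ≤ 1` and `|q_n| ≤ 2`. For `α < 0` its maximum is at `0`, where explicit
values give `q_n = O(n^(-α))`, cancelling the factor `n^α`. -/

theorem succ_add_two_mul_pos (hα : -1 / 2 < α) (n : ℕ) : 0 < (n : ℝ) + 1 + 2 * α := by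
  have : (0 : ℝ) ≤ n := n.cast_nonneg
  linarith

theorem succ_add_pos (hα : -1 / 2 < α) (n : ℕ) : 0 < (n : ℝ) + 1 + α := by
  have : (0 : ℝ) ≤ n := n.cast_nonneg
  linarith

theorem gegenbauer_zero : gegenbauer α 0 = 1 := by rw [gegenbauer]

theorem gegenbauer_one : gegenbauer α 1 = X := by rw [gegenbauer]

theorem gegenbauer_rec (hα : -1 / 2 < α) (n : ℕ) :
    C ((n : ℝ) + 1 + 2 * α) * gegenbauer α (n + 2) =
      C (2 * ((n : ℝ) + 1 + α)) * X * gegenbauer α (n + 1) - C ((n : ℝ) + 1) * gegenbauer α n := by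
  rw [gegenbauer, ← mul_assoc, ← C_mul, mul_one_div_cancel (succ_add_two_mul_pos hα n).ne', C_1,
    one_mul]

theorem aeval_gegenbauer_rec {R : Type*} [CommRing R] [Algebra ℝ R] (hα : -1 / 2 < α) (n : ℕ)
    (z : R) :
    algebraMap ℝ R ((n : ℝ) + 1 + 2 * α) * aeval z (gegenbauer α (n + 2)) =
      algebraMap ℝ R (2 * ((n : ℝ) + 1 + α)) * z * aeval z (gegenbauer α (n + 1)) -
        algebraMap ℝ R ((n : ℝ) + 1) * aeval z (gegenbauer α n) := by
  simpa only [map_mul, map_sub, aeval_C, aeval_X] using congrArg (aeval z) (gegenbauer_rec hα n)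

theorem eval_gegenbauer_rec (hα : -1 / 2 < α) (n : ℕ) (x : ℝ) :
    ((n : ℝ) + 1 + 2 * α) * (gegenbauer α (n + 2)).eval x =
      2 * ((n : ℝ) + 1 + α) * x * (gegenbauer α (n + 1)).eval x -
        ((n : ℝ) + 1) * (gegenbauer α n).eval x := by
  simpa only [eval_mul, eval_sub, eval_C, eval_X] using congrArg (eval x) (gegenbauer_rec hα n)

theorem natDegree_gegenbauer_le (n : ℕ) : (gegenbauer α n).natDegree ≤ n := by
  induction n using Nat.twoStepInduction with
  | zero => simp [gegenbauer_zero]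
  | one => simp [gegenbauer_one]
  | more n ih1 ih2 =>
    rw [gegenbauer]
    refine (natDegree_C_mul_le _ _).trans ((natDegree_sub_le _ _).trans (max_le ?_ ?_))
    · rw [mul_assoc]
      refine (natDegree_C_mul_le _ _).trans (natDegree_mul_le.trans ?_)
      have := natDegree_X_le (R := ℝ)
      omega
    · exact (natDegree_C_mul_le _ _).trans (by omega)

/-- Top coefficients in the recurrence give a telescoping product. The index starts at degree `1`
because the formula continued to degree `0` contains `Γ(α) / Γ(2α)`, singular at `α = 0`. -/
theorem coeff_gegenbauer_succ (hα : -1 / 2 < α) (n : ℕ) :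
    (gegenbauer α (n + 1)).coeff (n + 1) =
      2 ^ n * (Real.Gamma (n + α + 1) * Real.Gamma (2 * α + 1)) /
        (Real.Gamma (n + 2 * α + 1) * Real.Gamma (α + 1)) := by
  induction n with
  | zero =>
    have h1 : Real.Gamma (α + 1) ≠ 0 := (Real.Gamma_pos_of_pos (by linarith)).ne'
    have h2 : Real.Gamma (2 * α + 1) ≠ 0 := (Real.Gamma_pos_of_pos (by linarith)).ne'
    simp only [gegenbauer_one, zero_add, coeff_X_one, Nat.cast_zero, pow_zero]
    rw [one_mul, mul_comm, div_self (mul_ne_zero h2 h1)]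
  | succ n ih =>
    have key := congrArg (fun p => p.coeff (n + 2)) (gegenbauer_rec hα n)
    simp only [coeff_sub, mul_assoc, coeff_C_mul, coeff_X_mul] at key
    rw [coeff_eq_zero_of_natDegree_lt (lt_of_le_of_lt (natDegree_gegenbauer_le n) (by omega)), ih]
      at key
    have hp := succ_add_two_mul_pos hα n
    have hq := succ_add_pos hα n
    have e1 : Real.Gamma (((n + 1 : ℕ) : ℝ) + α + 1) = (n + α + 1) * Real.Gamma (n + α + 1) := by
      rw [← Real.Gamma_add_one (by linarith)]; push_cast; congr 1; ring
    have e2 : Real.Gamma (((n + 1 : ℕ) : ℝ) + 2 * α + 1) =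
        (n + 2 * α + 1) * Real.Gamma (n + 2 * α + 1) := by
      rw [← Real.Gamma_add_one (by linarith)]; push_cast; congr 1; ring
    have h1 : Real.Gamma (α + 1) ≠ 0 := (Real.Gamma_pos_of_pos (by linarith)).ne'
    have h2 : Real.Gamma (n + 2 * α + 1) ≠ 0 := (Real.Gamma_pos_of_pos (by linarith)).ne'
    have h3 : (n : ℝ) + 2 * α + 1 ≠ 0 := by linarith
    rw [e1, e2]
    rw [show n + 1 + 1 = n + 2 from rfl]
    apply mul_left_cancel₀ hp.ne'
    rw [key]
    field_simp
    ring

theorem coeff_gegenbauer_succ_pos (hα : -1 / 2 < α) (n : ℕ) :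
    0 < (gegenbauer α (n + 1)).coeff (n + 1) := by
  rw [coeff_gegenbauer_succ hα]
  have hp := succ_add_two_mul_pos hα n
  have hq := succ_add_pos hα n
  have h1 := Real.Gamma_pos_of_pos (show 0 < α + 1 by linarith)
  have h2 := Real.Gamma_pos_of_pos (show 0 < 2 * α + 1 by linarith)
  have h3 := Real.Gamma_pos_of_pos (show 0 < n + 2 * α + 1 by linarith)
  have h4 := Real.Gamma_pos_of_pos (show 0 < n + α + 1 by linarith)
  positivity

theorem natDegree_gegenbauer_succ (hα : -1 / 2 < α) (n : ℕ) :
    (gegenbauer α (n + 1)).natDegree = n + 1 :=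
  le_antisymm (natDegree_gegenbauer_le _)
    (le_natDegree_of_ne_zero (coeff_gegenbauer_succ_pos hα n).ne')

theorem leadCoeff_succ (hα : -1 / 2 < α) (n : ℕ) :
    leadCoeff α (n + 1) =
      2 ^ n * (Real.Gamma (n + α + 1) * Real.Gamma (2 * α + 1)) /
        (Real.Gamma (n + 2 * α + 1) * Real.Gamma (α + 1)) := by
  rw [leadCoeff, leadingCoeff, natDegree_gegenbauer_succ hα, coeff_gegenbauer_succ hα]

theorem leadCoeff_succ_pos (hα : -1 / 2 < α) (n : ℕ) : 0 < leadCoeff α (n + 1) := by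
  rw [leadCoeff, leadingCoeff, natDegree_gegenbauer_succ hα]
  exact coeff_gegenbauer_succ_pos hα n

theorem eval_one_gegenbauer (hα : -1 / 2 < α) (n : ℕ) : (gegenbauer α n).eval 1 = 1 := by
  induction n using Nat.twoStepInduction with
  | zero => simp [gegenbauer_zero]
  | one => simp [gegenbauer_one]
  | more n ih1 ih2 =>
    apply mul_left_cancel₀ (succ_add_two_mul_pos hα n).ne'
    rw [eval_gegenbauer_rec hα, ih1, ih2]
    ring

theorem eval_neg_gegenbauer (hα : -1 / 2 < α) (n : ℕ) (x : ℝ) :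
    (gegenbauer α n).eval (-x) = (-1) ^ n * (gegenbauer α n).eval x := by
  induction n using Nat.twoStepInduction with
  | zero => simp [gegenbauer_zero]
  | one => simp [gegenbauer_one]
  | more n ih1 ih2 =>
    apply mul_left_cancel₀ (succ_add_two_mul_pos hα n).ne'
    rw [mul_left_comm, eval_gegenbauer_rec hα, eval_gegenbauer_rec hα, ih1, ih2]
    ring

/-- The relations are proved together: the first advances by adding the recurrence to the second,
while the second advances by differentiating the recurrence, which needs both. -/
theorem one_sub_sq_mul_derivative_and (hα : -1 / 2 < α) (n : ℕ) :
    (1 - X ^ 2) * derivative (gegenbauer α n) =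
        C ((n : ℝ) + 2 * α) * (X * gegenbauer α n - gegenbauer α (n + 1)) ∧
      (1 - X ^ 2) * derivative (gegenbauer α (n + 1)) =
        C ((n : ℝ) + 1) * (gegenbauer α n - X * gegenbauer α (n + 1)) := by
  induction n with
  | zero =>
    simp [gegenbauer_zero, gegenbauer_one]
    ring
  | succ n ih =>
    obtain ⟨h1, h2⟩ := ih
    have hr := gegenbauer_rec hα n
    have hd := congrArg derivative hr
    simp only [derivative_mul, derivative_sub, derivative_C, derivative_X, zero_mul, zero_add,
      mul_one] at hd
    have hc : (C ((n : ℝ) + 1 + 2 * α) : ℝ[X]) ≠ 0 :=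
      C_ne_zero.2 (succ_add_two_mul_pos hα n).ne'
    simp only [map_add, map_mul, map_one, map_natCast, map_ofNat, Nat.cast_add, Nat.cast_one]
      at h1 h2 hr hd hc ⊢
    rw [show n + 1 + 1 = n + 2 from rfl]
    constructor
    · linear_combination h2 + hr
    · apply mul_left_cancel₀ hc
      linear_combination (1 - X ^ 2) * hd + 2 * (n + 1 + C α) * X * h2 - (n + 1 : ℝ[X]) * h1 +
        (n + 2) * X * hr

theorem one_sub_sq_mul_derivative (hα : -1 / 2 < α) (n : ℕ) :
    (1 - X ^ 2) * derivative (gegenbauer α n) =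
      C ((n : ℝ) + 2 * α) * (X * gegenbauer α n - gegenbauer α (n + 1)) :=
  (one_sub_sq_mul_derivative_and hα n).1

theorem one_sub_sq_mul_derivative_succ (hα : -1 / 2 < α) (n : ℕ) :
    (1 - X ^ 2) * derivative (gegenbauer α (n + 1)) =
      C ((n : ℝ) + 1) * (gegenbauer α n - X * gegenbauer α (n + 1)) :=
  (one_sub_sq_mul_derivative_and hα n).2

theorem one_sub_X_sq_ne_zero : (1 - X ^ 2 : ℝ[X]) ≠ 0 := by
  intro h
  simpa using congrArg (eval 0) h

/-- The Gegenbauer differential equation. -/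
theorem gegenbauer_ode (hα : -1 / 2 < α) (n : ℕ) :
    (1 - X ^ 2) * derivative (derivative (gegenbauer α n)) =
      C (2 * α + 1) * X * derivative (gegenbauer α n) -
        C (n * (n + 2 * α)) * gegenbauer α n := by
  have h1 := one_sub_sq_mul_derivative hα n
  have h2 := one_sub_sq_mul_derivative_succ hα n
  have hd := congrArg derivative h1
  simp only [derivative_mul, derivative_sub, derivative_C, derivative_X, zero_mul, zero_add,
    derivative_one, derivative_X_pow, one_mul] at hd
  simp only [map_add, map_mul, map_one, map_natCast, map_ofNat] at h1 h2 hd ⊢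
  -- Eliminating `G_{n+1}` between the two relations expresses its derivative through `G_n`, so the
  -- differentiated first relation becomes an equation for `G_n` alone.
  have h3 : ((n : ℝ[X]) + 2 * C α) * derivative (gegenbauer α (n + 1)) =
      (n + 1 : ℝ[X]) * (((n : ℝ[X]) + 2 * C α) * gegenbauer α n + X * derivative (gegenbauer α n)) := by
    apply mul_left_cancel₀ one_sub_X_sq_ne_zero
    linear_combination ((n : ℝ[X]) + 2 * C α) * h2 - (n + 1 : ℝ[X]) * X * h1
  norm_num at hd
  linear_combination hd - h3

theorem eval_one_derivative_gegenbauer (hα : -1 / 2 < α) (n : ℕ) :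
    (2 * α + 1) * (derivative (gegenbauer α n)).eval 1 = n * (n + 2 * α) := by
  have h := congrArg (eval 1) (gegenbauer_ode hα n)
  simp only [eval_mul, eval_sub, eval_C, eval_X, eval_pow, eval_one, eval_one_gegenbauer hα] at h
  linarith

/-- The constant in the Christoffel-Darboux formula. -/
def darbouxConst (α : ℝ) (n : ℕ) : ℝ :=
  Real.Gamma (n + 2 * α + 1) / (2 ^ (2 * α) * (n.factorial : ℝ) * Real.Gamma (α + 1 / 2) ^ 2)

theorem darbouxConst_pos (hα : -1 / 2 < α) (n : ℕ) : 0 < darbouxConst α n := by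
  have hp := succ_add_two_mul_pos hα n
  have h1 := Real.Gamma_pos_of_pos (show 0 < α + 1 / 2 by linarith)
  have h3 := Real.Gamma_pos_of_pos (show 0 < n + 2 * α + 1 by linarith)
  have : (0 : ℝ) < n.factorial := by exact_mod_cast n.factorial_pos
  unfold darbouxConst
  positivity

theorem darbouxConst_zero : (normSq α 0)⁻¹ = darbouxConst α 0 := by
  simp [normSq, darbouxConst]

theorem darbouxConst_succ (hα : -1 / 2 < α) (n : ℕ) :
    ((n : ℝ) + 1) * darbouxConst α (n + 1) = (n + 1 + 2 * α) * darbouxConst α n := by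
  have hp := succ_add_two_mul_pos hα n
  have h1 := (Real.Gamma_pos_of_pos (show 0 < α + 1 / 2 by linarith)).ne'
  have e2 : Real.Gamma (((n + 1 : ℕ) : ℝ) + 2 * α + 1) =
      (n + 2 * α + 1) * Real.Gamma (n + 2 * α + 1) := by
    rw [← Real.Gamma_add_one (by linarith)]; push_cast; congr 1; ring
  have : (0 : ℝ) < n.factorial := by exact_mod_cast n.factorial_pos
  have h2 : (0 : ℝ) < 2 ^ (2 * α) := by positivity
  rw [darbouxConst, darbouxConst, e2, Nat.factorial_succ]
  push_cast
  field_simp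
  ring

/-- With `darbouxConst_zero` and `darbouxConst_succ`, this is all that is needed about the `λ_j`. -/
theorem inv_normSq_succ (hα : -1 / 2 < α) (n : ℕ) :
    (n + 1 + 2 * α) * (normSq α (n + 1))⁻¹ = 2 * (n + 1 + α) * darbouxConst α (n + 1) := by
  have hp := succ_add_two_mul_pos hα n
  have hq := succ_add_pos hα n
  have h1 := (Real.Gamma_pos_of_pos (show 0 < α + 1 / 2 by linarith)).ne'
  have h3 := (Real.Gamma_pos_of_pos (show 0 < n + 2 * α + 1 by linarith)).ne'
  have e2 : Real.Gamma (((n + 1 : ℕ) : ℝ) + 2 * α + 1) =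
      (n + 2 * α + 1) * Real.Gamma (n + 2 * α + 1) := by
    rw [← Real.Gamma_add_one (by linarith)]; push_cast; congr 1; ring
  have e3 : Real.Gamma (((n + 1 : ℕ) : ℝ) + 2 * α) = Real.Gamma (n + 2 * α + 1) := by
    push_cast; congr 1; ring
  have e4 : (2 : ℝ) ^ (2 * α - 1) = 2 ^ (2 * α) / 2 := by
    rw [Real.rpow_sub_one two_ne_zero]
  have : (0 : ℝ) < (n + 1).factorial := by exact_mod_cast (n + 1).factorial_pos
  have h2 : (0 : ℝ) < 2 ^ (2 * α) := by positivity
  rw [darbouxConst, normSq, if_neg n.succ_ne_zero, e2, e3, e4]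
  push_cast
  field_simp
  ring

theorem inv_normSq_pos (hα : -1 / 2 < α) (n : ℕ) : 0 < (normSq α n)⁻¹ := by
  cases n with
  | zero => rw [darbouxConst_zero]; exact darbouxConst_pos hα 0
  | succ n =>
    have h := inv_normSq_succ hα n
    have h1 := mul_pos (mul_pos two_pos (succ_add_pos hα n)) (darbouxConst_pos hα (n + 1))
    rw [← h] at h1
    exact pos_of_mul_pos_right h1 (succ_add_two_mul_pos hα n).le

/-- The Christoffel-Darboux formula, in an arbitrary commutative `ℝ`-algebra. -/
theorem christoffel_darboux {R : Type*} [CommRing R] [Algebra ℝ R] (hα : -1 / 2 < α) (n : ℕ)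
    (z w : R) :
    (z - w) * ∑ j ∈ Finset.range (n + 1), algebraMap ℝ R (normSq α j)⁻¹ *
        (aeval z (gegenbauer α j) * aeval w (gegenbauer α j)) =
      algebraMap ℝ R (darbouxConst α n) *
        (aeval z (gegenbauer α (n + 1)) * aeval w (gegenbauer α n) -
          aeval z (gegenbauer α n) * aeval w (gegenbauer α (n + 1))) := by
  induction n with
  | zero =>
    simp [gegenbauer_zero, gegenbauer_one, darbouxConst_zero]
    ring
  | succ n ih =>
    rw [Finset.sum_range_succ, mul_add, ih]
    have hp := succ_add_two_mul_pos hα n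
    -- `R` may have zero divisors, so the scalar is cancelled through its inverse.
    have hu : algebraMap ℝ R (n + 1 + 2 * α)⁻¹ * algebraMap ℝ R (n + 1 + 2 * α) = 1 := by
      rw [← map_mul, inv_mul_cancel₀ hp.ne', map_one]
    have hcan : ∀ a b : R, algebraMap ℝ R (n + 1 + 2 * α) * a =
        algebraMap ℝ R (n + 1 + 2 * α) * b → a = b := by
      intro a b h
      have := congrArg (fun t => algebraMap ℝ R (n + 1 + 2 * α)⁻¹ * t) h
      simpa only [← mul_assoc, hu, one_mul] using this
    have hz := aeval_gegenbauer_rec hα n z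
    have hw := aeval_gegenbauer_rec hα n w
    have h1 := congrArg (algebraMap ℝ R) (darbouxConst_succ hα n)
    have h2 := congrArg (algebraMap ℝ R) (inv_normSq_succ hα n)
    apply hcan
    rw [show n + 1 + 1 = n + 2 from rfl]
    rw [map_mul, map_mul] at h1 h2
    linear_combination (-algebraMap ℝ R (darbouxConst α (n + 1)) *
        aeval w (gegenbauer α (n + 1))) * hz +
      (algebraMap ℝ R (darbouxConst α (n + 1)) * aeval z (gegenbauer α (n + 1))) * hw -
      (aeval z (gegenbauer α (n + 1)) * aeval w (gegenbauer α n) -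
          aeval z (gegenbauer α n) * aeval w (gegenbauer α (n + 1))) * h1 +
      (z - w) * (aeval z (gegenbauer α (n + 1)) * aeval w (gegenbauer α (n + 1))) * h2

/-! ### The zeros of the Radau polynomial -/

theorem natDegree_radauPoly (hα : -1 / 2 < α) (n : ℕ) : (radauPoly α n).natDegree = n + 1 := by
  have h := natDegree_gegenbauer_succ hα n
  rw [radauPoly, natDegree_sub_eq_left_of_natDegree_lt, h]
  rw [h]
  exact Nat.lt_succ_of_le (natDegree_gegenbauer_le n)

theorem leadingCoeff_radauPoly (hα : -1 / 2 < α) (n : ℕ) :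
    (radauPoly α n).leadingCoeff = leadCoeff α (n + 1) := by
  rw [leadCoeff, leadingCoeff, leadingCoeff, natDegree_radauPoly hα, natDegree_gegenbauer_succ hα,
    radauPoly, coeff_sub, coeff_eq_zero_of_natDegree_lt (Nat.lt_succ_of_le
      (natDegree_gegenbauer_le n)), sub_zero]

theorem radauPoly_ne_zero (hα : -1 / 2 < α) (n : ℕ) : radauPoly α n ≠ 0 := by
  rw [← leadingCoeff_ne_zero, leadingCoeff_radauPoly hα]
  exact (leadCoeff_succ_pos hα n).ne'

/-- In Christoffel-Darboux at `z` and its conjugate the right side vanishes, while the sum is `∑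
λ_j⁻¹ |G_j(z)|² ≥ λ_0⁻¹ > 0`. Hence `z` equals its conjugate. -/
theorem im_eq_zero_of_aeval_radauPoly (hα : -1 / 2 < α) (n : ℕ) {z : ℂ}
    (hz : aeval z (radauPoly α n) = 0) : z.im = 0 := by
  by_contra him
  have hcd := christoffel_darboux hα n z (starRingEnd ℂ z)
  have hconj : ∀ p : ℝ[X], aeval (starRingEnd ℂ z) p = starRingEnd ℂ (aeval z p) := fun p =>
    aeval_conj p z
  rw [radauPoly, map_sub, sub_eq_zero] at hz
  simp only [hconj, hz, sub_self, mul_zero, mul_eq_zero] at hcd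
  rcases hcd with h | h
  · apply him
    rw [sub_eq_zero] at h
    exact Complex.conj_eq_iff_im.1 h.symm
  · simp only [Complex.mul_conj, Complex.coe_algebraMap, ← Complex.ofReal_mul] at h
    rw [← Complex.ofReal_sum, Complex.ofReal_eq_zero] at h
    have h0 := (Finset.sum_eq_zero_iff_of_nonneg (fun j _ =>
      mul_nonneg (inv_normSq_pos hα j).le (Complex.normSq_nonneg _))).1 h 0 (by simp)
    rw [gegenbauer_zero] at h0
    simp [(inv_normSq_pos hα 0).ne'] at h0

theorem splits_radauPoly (hα : -1 / 2 < α) (n : ℕ) : (radauPoly α n).Splits := by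
  refine Splits.of_splits_map (algebraMap ℝ ℂ) (IsAlgClosed.splits _) fun z hz => ?_
  have h : aeval z (radauPoly α n) = 0 := by
    rw [← eval_map_algebraMap]
    exact isRoot_of_mem_roots hz
  exact ⟨z.re, Complex.ext rfl (by simp [im_eq_zero_of_aeval_radauPoly hα n h])⟩

/-- The Christoffel-Darboux kernel `∑ λ_j⁻¹ G_j(y) G_j` as a polynomial. -/
def kernelPoly (α : ℝ) (n : ℕ) (y : ℝ) : ℝ[X] :=
  ∑ j ∈ Finset.range (n + 1), C ((normSq α j)⁻¹ * (gegenbauer α j).eval y) * gegenbauer α j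

theorem eval_kernelPoly (n : ℕ) (y x : ℝ) :
    (kernelPoly α n y).eval x = ∑ j ∈ Finset.range (n + 1),
      (normSq α j)⁻¹ * (gegenbauer α j).eval y * (gegenbauer α j).eval x := by
  simp [kernelPoly, eval_finsetSum]

theorem natDegree_kernelPoly_le (n : ℕ) (y : ℝ) : (kernelPoly α n y).natDegree ≤ n := by
  refine natDegree_sum_le_of_forall_le _ _ fun j hj => ?_
  refine (natDegree_C_mul_le _ _).trans ((natDegree_gegenbauer_le j).trans ?_)
  have := Finset.mem_range.1 hj
  omega

theorem X_sub_C_mul_kernelPoly (hα : -1 / 2 < α) (n : ℕ) {y : ℝ}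
    (hy : (radauPoly α n).eval y = 0) :
    (X - C y) * kernelPoly α n y =
      C (darbouxConst α n * (gegenbauer α n).eval y) * radauPoly α n := by
  have h := christoffel_darboux hα n (X : ℝ[X]) (C y)
  have hC : ∀ p : ℝ[X], aeval (C y) p = C (p.eval y) := fun p => by
    rw [← algebraMap_eq, aeval_algebraMap_apply, coe_aeval_eq_eval]
  rw [radauPoly, eval_sub, sub_eq_zero] at hy
  simp only [aeval_X_left_apply, hC, algebraMap_eq, hy] at h
  rw [kernelPoly, radauPoly, C_mul]
  convert h using 1
  · congr 1
    refine Finset.sum_congr rfl fun j _ => ?_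
    rw [C_mul]
    ring
  · ring

theorem eval_kernelPoly_self (hα : -1 / 2 < α) (n : ℕ) {y : ℝ}
    (hy : (radauPoly α n).eval y = 0) :
    (kernelPoly α n y).eval y =
      darbouxConst α n * (gegenbauer α n).eval y * (derivative (radauPoly α n)).eval y := by
  have h := congrArg (fun p => (derivative p).eval y) (X_sub_C_mul_kernelPoly hα n hy)
  simpa using h

theorem eval_kernelPoly_of_ne (hα : -1 / 2 < α) (n : ℕ) {x y : ℝ}
    (hy : (radauPoly α n).eval y = 0) (hx : (radauPoly α n).eval x = 0) (hxy : x ≠ y) :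
    (kernelPoly α n y).eval x = 0 := by
  have h := congrArg (eval x) (X_sub_C_mul_kernelPoly hα n hy)
  simp only [eval_mul, eval_sub, eval_X, eval_C, hx, mul_zero, mul_eq_zero, sub_eq_zero] at h
  exact h.resolve_left hxy

theorem eval_kernelPoly_self_pos (hα : -1 / 2 < α) (n : ℕ) (y : ℝ) :
    0 < (kernelPoly α n y).eval y := by
  rw [eval_kernelPoly]
  refine Finset.sum_pos' (fun j _ => ?_) ⟨0, by simp, ?_⟩
  · rw [mul_assoc]
    exact mul_nonneg (inv_normSq_pos hα j).le (mul_self_nonneg _)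
  · simpa [gegenbauer_zero] using inv_normSq_pos hα 0

/-- At a double zero the confluent formula `eval_kernelPoly_self` would make the positive diagonal
kernel vanish. -/
theorem nodup_roots_radauPoly (hα : -1 / 2 < α) (n : ℕ) : (radauPoly α n).roots.Nodup := by
  rw [Multiset.nodup_iff_count_le_one]
  intro y
  rw [count_roots]
  by_contra hlt
  rw [not_le, one_lt_rootMultiplicity_iff_isRoot (radauPoly_ne_zero hα n)] at hlt
  have h := eval_kernelPoly_self_pos hα n y
  rw [eval_kernelPoly_self hα n hlt.1, hlt.2.eq_zero, mul_zero] at h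
  exact h.false

/-- The recurrence reads `(n+1+2α)(G_{n+2} - G_{n+1}) = 2(n+1+α)(x-1) G_{n+1} + (n+1)(G_{n+1} -
G_n)`, with both terms on the right nonnegative by induction. -/
theorem gegenbauer_pos_and_lt (hα : -1 / 2 < α) {x : ℝ} (hx : 1 < x) (n : ℕ) :
    0 < (gegenbauer α n).eval x ∧ (gegenbauer α n).eval x < (gegenbauer α (n + 1)).eval x := by
  induction n with
  | zero => simp [gegenbauer_zero, gegenbauer_one, hx]
  | succ n ih =>
    have h0 := ih.1.trans ih.2
    refine ⟨h0, ?_⟩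
    have hr := eval_gegenbauer_rec hα n x
    have h1 := mul_pos (mul_pos (mul_pos two_pos (succ_add_pos hα n)) (sub_pos.2 hx)) h0
    have h2 : 0 ≤ ((n : ℝ) + 1) *
        ((gegenbauer α (n + 1)).eval x - (gegenbauer α n).eval x) :=
      mul_nonneg (by positivity) (sub_nonneg.2 ih.2.le)
    refine lt_of_mul_lt_mul_left ?_ (succ_add_two_mul_pos hα n).le
    rw [show n + 1 + 1 = n + 2 from rfl]
    linarith

theorem eval_one_radauPoly (hα : -1 / 2 < α) (n : ℕ) : (radauPoly α n).eval 1 = 0 := by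
  simp [radauPoly, eval_one_gegenbauer hα]

theorem le_one_of_eval_radauPoly (hα : -1 / 2 < α) (n : ℕ) {y : ℝ}
    (hy : (radauPoly α n).eval y = 0) : y ≤ 1 := by
  by_contra! h
  have := gegenbauer_pos_and_lt hα h n
  rw [radauPoly, eval_sub] at hy
  linarith

theorem neg_one_lt_of_eval_radauPoly (hα : -1 / 2 < α) (n : ℕ) {y : ℝ}
    (hy : (radauPoly α n).eval y = 0) : -1 < y := by
  by_contra! h
  have e1 := eval_neg_gegenbauer hα n (-y)
  have e2 := eval_neg_gegenbauer hα (n + 1) (-y)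
  rw [neg_neg] at e1 e2
  rw [radauPoly, eval_sub, e1, e2, pow_succ] at hy
  have hpos : 0 < (gegenbauer α n).eval (-y) ∧ 0 < (gegenbauer α (n + 1)).eval (-y) := by
    rcases h.eq_or_lt with rfl | h
    · simp [eval_one_gegenbauer hα]
    · have := gegenbauer_pos_and_lt hα (show 1 < -y by linarith) n
      exact ⟨this.1, this.1.trans this.2⟩
  have hz : (-1 : ℝ) ^ n * ((gegenbauer α n).eval (-y) + (gegenbauer α (n + 1)).eval (-y)) = 0 := by
    linarith
  rcases mul_eq_zero.1 hz with h0 | h0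
  · exact pow_ne_zero n (by norm_num) h0
  · linarith [hpos.1, hpos.2]

theorem card_roots_radauPoly (hα : -1 / 2 < α) (n : ℕ) :
    (radauPoly α n).roots.card = n + 1 := by
  rw [← (splits_radauPoly hα n).natDegree_eq_card_roots, natDegree_radauPoly hα]

/-- All `n + 1` roots are real, so the default `0` in `node` is never reached. -/
theorem node_eq_getElem (hα : -1 / 2 < α) {n k : ℕ} (hk : k < n + 1) :
    node α n k = ((radauPoly α n).roots.sort (· ≥ ·))[k]'(by
      rwa [Multiset.length_sort, card_roots_radauPoly hα]) := by
  rw [node, List.getD_eq_getElem]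

theorem eval_node (hα : -1 / 2 < α) {n k : ℕ} (hk : k < n + 1) :
    (radauPoly α n).eval (node α n k) = 0 := by
  rw [node_eq_getElem hα hk]
  exact isRoot_of_mem_roots ((Multiset.mem_sort _).1 (List.getElem_mem _))

theorem node_inj (hα : -1 / 2 < α) {n i k : ℕ} (hi : i < n + 1) (hk : k < n + 1) :
    node α n i = node α n k ↔ i = k := by
  rw [node_eq_getElem hα hi, node_eq_getElem hα hk]
  refine List.Nodup.getElem_inj_iff ?_
  rw [← Multiset.coe_nodup, Multiset.sort_eq]
  exact nodup_roots_radauPoly hα n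

theorem node_zero (hα : -1 / 2 < α) (n : ℕ) : node α n 0 = 1 := by
  refine le_antisymm (le_one_of_eval_radauPoly hα n (eval_node hα n.succ_pos)) ?_
  have h1 : (1 : ℝ) ∈ (radauPoly α n).roots.sort (· ≥ ·) :=
    (Multiset.mem_sort _).2 ((mem_roots (radauPoly_ne_zero hα n)).2 (eval_one_radauPoly hα n))
  obtain ⟨k, hk, hk1⟩ := List.getElem_of_mem h1
  rw [node_eq_getElem hα n.succ_pos]
  conv_lhs => rw [← hk1]
  rcases k.eq_zero_or_pos with rfl | hpos
  · exact le_rfl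
  · exact List.pairwise_iff_getElem.1
      (Multiset.pairwise_sort (radauPoly α n).roots (· ≥ ·)) _ _ _ _ hpos

theorem node_le_one (hα : -1 / 2 < α) {n k : ℕ} (hk : k < n + 1) : node α n k ≤ 1 :=
  le_one_of_eval_radauPoly hα n (eval_node hα hk)

theorem neg_one_lt_node (hα : -1 / 2 < α) {n k : ℕ} (hk : k < n + 1) : -1 < node α n k :=
  neg_one_lt_of_eval_radauPoly hα n (eval_node hα hk)

/-! ### The quadrature weights -/

/-- Subtracting the derivative relations at `y`, where `G_{n+1} = G_n`, leaves a common factor `1 -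
y`. At `y = 1` the differential equation is used instead, which accounts for the factor `α + 1/2` in
the weight there. -/
theorem one_add_mul_eval_derivative_radauPoly (hα : -1 / 2 < α) (n : ℕ) {y : ℝ}
    (hy : (radauPoly α n).eval y = 0) (hy1 : y ≠ 1) :
    (1 + y) * (derivative (radauPoly α n)).eval y =
      (2 * n + 1 + 2 * α) * (gegenbauer α n).eval y := by
  have h1 := congrArg (eval y) (one_sub_sq_mul_derivative hα n)
  have h2 := congrArg (eval y) (one_sub_sq_mul_derivative_succ hα n)
  rw [radauPoly, eval_sub, sub_eq_zero] at hy
  simp only [eval_mul, eval_sub, eval_one, eval_pow, eval_X, eval_C, hy] at h1 h2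
  rw [radauPoly, derivative_sub, eval_sub]
  apply mul_left_cancel₀ (sub_ne_zero.2 hy1.symm)
  linear_combination h2 - h1

theorem eval_one_derivative_radauPoly (hα : -1 / 2 < α) (n : ℕ) :
    (2 * α + 1) * (derivative (radauPoly α n)).eval 1 = 2 * n + 1 + 2 * α := by
  have h1 := eval_one_derivative_gegenbauer hα n
  have h2 := eval_one_derivative_gegenbauer hα (n + 1)
  rw [radauPoly, derivative_sub, eval_sub]
  push_cast at h2
  linear_combination h2 - h1

theorem darbouxConst_mul_preWeight_const (hα : -1 / 2 < α) (n : ℕ) :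
    darbouxConst α n * (2 * n + 1 + 2 * α) * ((2 : ℝ) ^ (2 * α - 1) *
      (Real.Gamma (α + 1 / 2) ^ 2 * (n.factorial : ℝ) /
        (((n : ℝ) + α + 1 / 2) * Real.Gamma ((n : ℝ) + 2 * α + 1)))) = 1 := by
  have hp := succ_add_two_mul_pos hα n
  have h1 := (Real.Gamma_pos_of_pos (show 0 < α + 1 / 2 by linarith)).ne'
  have h3 := (Real.Gamma_pos_of_pos (show 0 < n + 2 * α + 1 by linarith)).ne'
  have e4 : (2 : ℝ) ^ (2 * α - 1) = 2 ^ (2 * α) / 2 := by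
    rw [Real.rpow_sub_one two_ne_zero]
  have hf : (n.factorial : ℝ) ≠ 0 := by exact_mod_cast n.factorial_ne_zero
  have h2 : (2 : ℝ) ^ (2 * α) ≠ 0 := by positivity
  have h5 : (n : ℝ) + α + 1 / 2 ≠ 0 := by
    have : (0 : ℝ) ≤ n := n.cast_nonneg
    linarith
  rw [darbouxConst, e4]
  generalize Real.Gamma (α + 1 / 2) = a at *
  generalize Real.Gamma ((n : ℝ) + 2 * α + 1) = b at *
  generalize (2 : ℝ) ^ (2 * α) = c at *
  rw [show 2 * (n : ℝ) + 1 + 2 * α = 2 * (n + α + 1 / 2) by ring]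
  generalize (n : ℝ) + α + 1 / 2 = d at *
  field_simp

theorem weight_mul_eval_kernelPoly_self (hα : -1 / 2 < α) {n k : ℕ} (hk : k < n + 1) :
    weight α n k * (kernelPoly α n (node α n k)).eval (node α n k) = 1 := by
  have hc := darbouxConst_mul_preWeight_const hα n
  have hy := eval_node hα hk
  have hpos := eval_kernelPoly_self_pos hα n (node α n k)
  have hself := eval_kernelPoly_self hα n hy
  have hg : (gegenbauer α n).eval (node α n k) ≠ 0 := by
    intro h0
    rw [hself, h0] at hpos
    simp at hpos
  rw [hself, weight, preWeight, preWeight]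
  split_ifs with h0
  · subst h0
    have hd := eval_one_derivative_radauPoly hα n
    rw [node_zero hα, eval_one_gegenbauer hα]
    linear_combination hc + (darbouxConst α n * ((2 : ℝ) ^ (2 * α - 1) *
      (Real.Gamma (α + 1 / 2) ^ 2 * (n.factorial : ℝ) /
        (((n : ℝ) + α + 1 / 2) * Real.Gamma ((n : ℝ) + 2 * α + 1))))) * hd
  · have hne : node α n k ≠ 1 := by
      rw [← node_zero hα n]
      exact fun h => h0 ((node_inj hα hk n.succ_pos).1 h)
    have hd := one_add_mul_eval_derivative_radauPoly hα n hy hne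
    have hg2 : (((gegenbauer α n).eval (node α n k)) ^ 2)⁻¹ *
        (gegenbauer α n).eval (node α n k) ^ 2 = 1 := inv_mul_cancel₀ (pow_ne_zero 2 hg)
    linear_combination ((2 : ℝ) ^ (2 * α - 1) *
      (Real.Gamma (α + 1 / 2) ^ 2 * (n.factorial : ℝ) /
        (((n : ℝ) + α + 1 / 2) * Real.Gamma ((n : ℝ) + 2 * α + 1))) *
        (((gegenbauer α n).eval (node α n k)) ^ 2)⁻¹ * darbouxConst α n *
        (gegenbauer α n).eval (node α n k)) * hd +
      ((((gegenbauer α n).eval (node α n k)) ^ 2)⁻¹ *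
        (gegenbauer α n).eval (node α n k) ^ 2) * hc + hg2

theorem weight_mul_eval_kernelPoly (hα : -1 / 2 < α) {n : ℕ} (i k : Fin (n + 1)) :
    weight α n k * (kernelPoly α n (node α n k)).eval (node α n i) = if k = i then 1 else 0 := by
  split_ifs with h
  · subst h
    exact weight_mul_eval_kernelPoly_self hα k.2
  · rw [eval_kernelPoly_of_ne hα n (eval_node hα k.2) (eval_node hα i.2), mul_zero]
    rw [Ne, node_inj hα i.2 k.2]
    exact fun h' => h (Fin.ext h'.symm)

/-! ### The error of polynomial interpolation -/

/-- Rolle's theorem for higher derivatives: if `g` has `m + 1` zeros in `[a, b]` then its `m`-th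
derivative has a zero there. -/
theorem exists_iteratedDerivWithin_eq_zero {a b : ℝ} (hab : a < b) (m : ℕ) {g : ℝ → ℝ}
    (hg : ContDiffOn ℝ (m : WithTop ℕ∞) g (Set.Icc a b)) {x : Fin (m + 1) → ℝ}
    (hx : StrictMono x) (hmem : ∀ i, x i ∈ Set.Icc a b) (h0 : ∀ i, g (x i) = 0) :
    ∃ ξ ∈ Set.Icc a b, iteratedDerivWithin m g (Set.Icc a b) ξ = 0 := by
  induction m generalizing g with
  | zero => exact ⟨x 0, hmem 0, by rw [iteratedDerivWithin_zero]; exact h0 0⟩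
  | succ m ih =>
    have hu := uniqueDiffOn_Icc hab
    have hg' : ContDiffOn ℝ ((m : WithTop ℕ∞) + 1) g (Set.Icc a b) := by exact_mod_cast hg
    have hd := ((contDiffOn_succ_iff_derivWithin hu).1 hg').2.2
    have key : ∀ i : Fin (m + 1), ∃ c ∈ Set.Ioo (x i.castSucc) (x i.succ),
        derivWithin g (Set.Icc a b) c = 0 := by
      intro i
      have hlt : x i.castSucc < x i.succ := hx Fin.castSucc_lt_succ
      have hsub : Set.Icc (x i.castSucc) (x i.succ) ⊆ Set.Icc a b :=
        Set.Icc_subset_Icc (hmem _).1 (hmem _).2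
      obtain ⟨c, hc, hc0⟩ := exists_deriv_eq_zero hlt (hg.continuousOn.mono hsub)
        (by rw [h0, h0])
      refine ⟨c, hc, ?_⟩
      rw [derivWithin_of_mem_nhds, hc0]
      -- Rolle points are interior, so the one-sided conventions at `a` and `b` do not matter.
      exact Icc_mem_nhds ((hmem _).1.trans_lt hc.1) (hc.2.trans_le (hmem _).2)
    choose c hc hc0 using key
    rw [iteratedDerivWithin_succ']
    refine ih hd (x := c) ?_ (fun i => ?_) hc0
    · intro i j hij
      refine (hc i).2.trans_le (le_trans (hx.monotone ?_) (hc j).1.le)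
      exact Fin.succ_le_castSucc_iff.2 hij
    · exact ⟨(hmem _).1.trans (hc i).1.le, (hc i).2.le.trans (hmem _).2⟩

theorem iteratedDerivWithin_eval {s : Set ℝ} (hs : UniqueDiffOn ℝ s) (p : ℝ[X]) (m : ℕ) {x : ℝ}
    (hx : x ∈ s) :
    iteratedDerivWithin m (fun t => p.eval t) s x = (derivative^[m] p).eval x := by
  induction m generalizing x with
  | zero => simp
  | succ m ih =>
    rw [iteratedDerivWithin_succ, derivWithin_congr (fun y hy => ih hy) (ih hx),
      Polynomial.derivWithin _ (hs x hx), Function.iterate_succ_apply']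

/-- The error bound for polynomial interpolation of `f` by `P` at the `n + 1` zeros of `Q`. -/
theorem abs_sub_interpolation_le {a b : ℝ} (hab : a < b) {n : ℕ} {f : ℝ → ℝ}
    (hf : ContDiffOn ℝ ((n + 1 : ℕ) : WithTop ℕ∞) f (Set.Icc a b)) {A : ℝ}
    (hA : ∀ x ∈ Set.Icc a b, |iteratedDerivWithin (n + 1) f (Set.Icc a b) x| ≤ A)
    {P Q : ℝ[X]} (hP : P.natDegree ≤ n) (hQ : Q.natDegree = n + 1) {s : Finset ℝ}
    (hcard : s.card = n + 1) (hs : ∀ x ∈ s, x ∈ Set.Icc a b) (hsQ : ∀ x ∈ s, Q.eval x = 0)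
    (hsP : ∀ x ∈ s, f x = P.eval x) {x : ℝ} (hx : x ∈ Set.Icc a b) :
    |f x - P.eval x| ≤ A / ((n + 1).factorial * |Q.leadingCoeff|) * |Q.eval x| := by
  have hA0 : 0 ≤ A := (abs_nonneg _).trans (hA x hx)
  by_cases hxs : x ∈ s
  · rw [hsP x hxs, sub_self, abs_zero]
    positivity
  have hQ0 : Q ≠ 0 := by
    rintro rfl
    simp at hQ
  have hQx : Q.eval x ≠ 0 := by
    intro h
    have hle : insert x s ⊆ Q.roots.toFinset := by
      intro y hy
      rw [Multiset.mem_toFinset, mem_roots hQ0]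
      rcases Finset.mem_insert.1 hy with rfl | hy
      · exact h
      · exact hsQ y hy
    have h1 := (Finset.card_le_card hle).trans (Multiset.toFinset_card_le _)
    have h2 := Q.card_roots'
    rw [Finset.card_insert_of_notMem hxs] at h1
    omega
  -- With this `c`, the polynomial `P + c Q` also agrees with `f` at `x`, so the difference has `n +
  -- 2` zeros and its derivative of order `n + 1` vanishes somewhere.
  set c : ℝ := (f x - P.eval x) / Q.eval x with hc
  set R : ℝ[X] := P + C c * Q with hR
  have hcx : c * Q.eval x = f x - P.eval x := div_mul_cancel₀ _ hQx
  have hcontR : ContDiffOn ℝ ((n + 1 : ℕ) : WithTop ℕ∞) (fun t => R.eval t) (Set.Icc a b) :=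
    R.contDiff_aeval _ |>.contDiffOn
  have hcard' : (insert x s).card = n + 1 + 1 := by
    rw [Finset.card_insert_of_notMem hxs, hcard]
  obtain ⟨ξ, hξ, h0⟩ := exists_iteratedDerivWithin_eq_zero hab (n + 1)
    (g := f - fun t => R.eval t) (hf.sub hcontR)
    (x := (insert x s).orderEmbOfFin hcard') (OrderEmbedding.strictMono _)
    (fun i => by
      rcases Finset.mem_insert.1 (Finset.orderEmbOfFin_mem _ hcard' i) with h | h
      · rw [h]; exact hx
      · exact hs _ h)
    (fun i => by
      rcases Finset.mem_insert.1 (Finset.orderEmbOfFin_mem _ hcard' i) with h | h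
      · simp [h, hR, hcx]
      · simp [hR, hsQ _ h, hsP _ h])
  have hu := uniqueDiffOn_Icc hab
  rw [iteratedDerivWithin_sub hξ hu (hf ξ hξ) (hcontR ξ hξ), iteratedDerivWithin_eval hu _ _ hξ,
    sub_eq_zero, hR, iterate_map_add, iterate_derivative_C_mul,
    iterate_derivative_eq_zero (Nat.lt_succ_of_le hP), zero_add] at h0
  have hQd : derivative^[n + 1] Q = C ((n + 1).factorial * Q.leadingCoeff) := by
    have hdeg : (derivative^[n + 1] Q).natDegree = 0 := by
      have := natDegree_iterate_derivative Q (n + 1)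
      omega
    rw [eq_C_of_natDegree_eq_zero hdeg, coeff_iterate_derivative, zero_add,
      Nat.descFactorial_self, leadingCoeff, hQ, nsmul_eq_mul]
  rw [hQd, eval_mul, eval_C, eval_C] at h0
  have hb := hA ξ hξ
  rw [h0, abs_mul, abs_mul, Nat.abs_cast] at hb
  have hl : 0 < ((n + 1).factorial : ℝ) * |Q.leadingCoeff| := by
    have : (0 : ℝ) < (n + 1).factorial := by exact_mod_cast (n + 1).factorial_pos
    have := abs_pos.2 (leadingCoeff_ne_zero.2 hQ0)
    positivity
  rw [← hcx, abs_mul]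
  exact mul_le_mul_of_nonneg_right ((le_div_iff₀ hl).2 hb) (abs_nonneg _)

/-! ### Growth of the Gamma function -/

theorem Gamma_add_nat {s : ℝ} (hs : 0 < s) (n : ℕ) :
    Real.Gamma (n + s) = Real.Gamma s * ∏ j ∈ Finset.range n, (s + j) := by
  induction n with
  | zero => simp
  | succ n ih =>
    have hn : (0 : ℝ) ≤ n := n.cast_nonneg
    rw [Finset.prod_range_succ, ← mul_assoc, ← ih, Nat.cast_add_one,
      show (n : ℝ) + 1 + s = (n + s) + 1 by ring, Real.Gamma_add_one (by linarith)]
    ring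

theorem GammaSeq_mul_Gamma {s : ℝ} (hs : 0 < s) (n : ℕ) :
    Real.GammaSeq s n * ((s + n) * Real.Gamma (n + s)) =
      Real.Gamma s * ((n : ℝ) ^ s * n.factorial) := by
  have hp : ∏ j ∈ Finset.range n, (s + j) ≠ 0 :=
    Finset.prod_ne_zero_iff.2 fun j _ => by positivity
  have hsn : s + (n : ℝ) ≠ 0 := by positivity
  rw [Real.GammaSeq, Gamma_add_nat hs, Finset.prod_range_succ]
  field_simp

/-- Up to the bounded factor `(t+n)/(s+n)`, the normalized quotient is a ratio of `Real.GammaSeq`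
terms. That ratio converges, hence is bounded for all `n` and not just eventually. -/
theorem exists_Gamma_add_le {s t : ℝ} (hs : 0 < s) (ht : 0 < t) :
    ∃ C : ℝ, 0 < C ∧ ∀ n : ℕ, 1 ≤ n →
      Real.Gamma (n + s) ≤ C * (n : ℝ) ^ (s - t) * Real.Gamma (n + t) := by
  have hGs := Real.Gamma_pos_of_pos hs
  have hGt := Real.Gamma_pos_of_pos ht
  have hlim : Filter.Tendsto (fun n => Real.GammaSeq t n / Real.GammaSeq s n) Filter.atTop
      (nhds (Real.Gamma t / Real.Gamma s)) :=
    (Real.GammaSeq_tendsto_Gamma t).div (Real.GammaSeq_tendsto_Gamma s) hGs.ne'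
  obtain ⟨D, hD⟩ := hlim.bddAbove_range
  have hD' : ∀ n, Real.GammaSeq t n / Real.GammaSeq s n ≤ D := fun n => hD ⟨n, rfl⟩
  refine ⟨(|D| + 1) * (Real.Gamma s / Real.Gamma t) * ((t + s) / s), by positivity,
    fun n hn => ?_⟩
  have hn0 : (0 : ℝ) < n := by exact_mod_cast hn
  have hS := GammaSeq_mul_Gamma hs n
  have hT := GammaSeq_mul_Gamma ht n
  have hps : 0 < Real.Gamma (n + s) := Real.Gamma_pos_of_pos (by positivity)
  have hpt : 0 < Real.Gamma (n + t) := Real.Gamma_pos_of_pos (by positivity)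
  have hf : (0 : ℝ) < n.factorial := by exact_mod_cast n.factorial_pos
  have hss : 0 < Real.GammaSeq s n := by
    refine pos_of_mul_pos_left (b := (s + n) * Real.Gamma (n + s)) ?_ (by positivity)
    rw [hS]; positivity
  have hst : 0 < Real.GammaSeq t n := by
    refine pos_of_mul_pos_left (b := (t + n) * Real.Gamma (n + t)) ?_ (by positivity)
    rw [hT]; positivity
  have e : Real.Gamma (n + s) = (Real.GammaSeq t n / Real.GammaSeq s n) *
      (Real.Gamma s / Real.Gamma t) * ((t + n) / (s + n)) * (n : ℝ) ^ (s - t) *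
        Real.Gamma (n + t) := by
    have e1 : (n : ℝ) ^ s = n ^ (s - t) * (n : ℝ) ^ t := by
      rw [← Real.rpow_add hn0, sub_add_cancel]
    rw [e1] at hS
    have h2 : 0 < (n : ℝ) ^ t := by positivity
    field_simp
    have h3 : Real.Gamma s * (↑n ^ (s - t) * ↑n ^ t * ↑n.factorial) * Real.Gamma t =
      (Real.Gamma t * (↑n ^ t * ↑n.factorial)) * (Real.Gamma s * n ^ (s - t)) := by ring
    rw [← hT] at h3
    rw [← hS] at h3
    linarith
  have h1 : (t + n) / (s + n) ≤ (t + s) / s := by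
    rw [div_le_div_iff₀ (by positivity) hs]
    nlinarith
  have h2 : Real.GammaSeq t n / Real.GammaSeq s n ≤ |D| + 1 :=
    (hD' n).trans ((le_abs_self D).trans (by linarith))
  rw [e]
  gcongr

/-- The lower Stirling bound for `(n + 1)!`. -/
theorem rpow_mul_exp_le_factorial_succ {n : ℕ} (hn : 1 ≤ n) :
    (n : ℝ) ^ ((n : ℝ) + 3 / 2) ≤ Real.exp 1 ^ n * ((n + 1).factorial : ℝ) := by
  have hn0 : (0 : ℝ) < n := by exact_mod_cast hn
  have h := Stirling.le_factorial_stirling n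
  have h1 : √(n : ℝ) ≤ √(2 * Real.pi * n) := by
    apply Real.sqrt_le_sqrt
    nlinarith [Real.pi_gt_three]
  have h2 : √(n : ℝ) * (n / Real.exp 1) ^ n ≤ (n.factorial : ℝ) :=
    (mul_le_mul_of_nonneg_right h1 (by positivity)).trans h
  have e : (n : ℝ) ^ ((n : ℝ) + 3 / 2) = (n : ℝ) ^ n * n * √n := by
    rw [show (n : ℝ) + 3 / 2 = n + 1 + 1 / 2 by ring, Real.rpow_add hn0, Real.rpow_add hn0,
      Real.rpow_natCast, Real.rpow_one, Real.sqrt_eq_rpow]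
  rw [div_pow, ← mul_div_assoc, div_le_iff₀ (by positivity)] at h2
  rw [e, Nat.factorial_succ]
  push_cast
  have hf : (0 : ℝ) < n.factorial := by exact_mod_cast n.factorial_pos
  have := mul_le_mul_of_nonneg_left h2 hn0.le
  have h3 : 0 < (n.factorial : ℝ) * Real.exp 1 ^ n := by positivity
  nlinarith

/-! ### Uniform bounds for the Gegenbauer polynomials -/

/-- The Sonin function `n (n + 2α) G_n² + (1 - x²) G_n'²`. -/
def sonin (α : ℝ) (n : ℕ) : ℝ[X] :=
  C (n * (n + 2 * α)) * gegenbauer α n ^ 2 + (1 - X ^ 2) * derivative (gegenbauer α n) ^ 2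

/-- The differential equation cancels every term except one whose sign on `[0, 1]` is that of `α`.
-/
theorem derivative_sonin (hα : -1 / 2 < α) (n : ℕ) :
    derivative (sonin α n) = C (4 * α) * X * derivative (gegenbauer α n) ^ 2 := by
  have h := gegenbauer_ode hα n
  simp only [sonin, derivative_add, derivative_mul, derivative_C, derivative_pow, derivative_sub,
    derivative_one, derivative_X, zero_mul, zero_add, zero_sub]
  simp only [map_add, map_mul, map_one, map_natCast, map_ofNat] at h ⊢
  norm_num
  linear_combination 2 * derivative (gegenbauer α n) * h

theorem eval_sonin (n : ℕ) (x : ℝ) :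
    (sonin α n).eval x = n * (n + 2 * α) * (gegenbauer α n).eval x ^ 2 +
      (1 - x ^ 2) * (derivative (gegenbauer α n)).eval x ^ 2 := by
  simp [sonin]

theorem eval_derivative_sonin (hα : -1 / 2 < α) (n : ℕ) (x : ℝ) :
    deriv (fun t => (sonin α n).eval t) x =
      4 * α * x * (derivative (gegenbauer α n)).eval x ^ 2 := by
  rw [Polynomial.deriv, derivative_sonin hα]
  simp

theorem sonin_monotoneOn (hα : 0 ≤ α) (n : ℕ) :
    MonotoneOn (fun t => (sonin α n).eval t) (Set.Icc 0 1) := by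
  refine monotoneOn_of_deriv_nonneg (convex_Icc 0 1) (sonin α n).continuousOn
    (sonin α n).differentiable.differentiableOn fun x hx => ?_
  rw [eval_derivative_sonin (by linarith)]
  have := (interior_subset hx : x ∈ Set.Icc (0 : ℝ) 1).1
  positivity

theorem sonin_antitoneOn (hα : -1 / 2 < α) (hα0 : α < 0) (n : ℕ) :
    AntitoneOn (fun t => (sonin α n).eval t) (Set.Icc 0 1) := by
  refine antitoneOn_of_deriv_nonpos (convex_Icc 0 1) (sonin α n).continuousOn
    (sonin α n).differentiable.differentiableOn fun x hx => ?_
  rw [eval_derivative_sonin hα]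
  have h0 := (interior_subset hx : x ∈ Set.Icc (0 : ℝ) 1).1
  refine mul_nonpos_of_nonpos_of_nonneg ?_ (sq_nonneg _)
  exact mul_nonpos_of_nonpos_of_nonneg (by linarith) h0

theorem abs_eval_gegenbauer_abs (hα : -1 / 2 < α) (n : ℕ) (x : ℝ) :
    |(gegenbauer α n).eval (|x|)| = |(gegenbauer α n).eval x| := by
  rcases abs_choice x with h | h
  · rw [h]
  · rw [h, eval_neg_gegenbauer hα, abs_mul, abs_pow, abs_neg, abs_one, one_pow, one_mul]

theorem mul_eval_gegenbauer_sq_le_sonin (n : ℕ) {x : ℝ} (hx : x ∈ Set.Icc (0 : ℝ) 1) :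
    n * (n + 2 * α) * (gegenbauer α n).eval x ^ 2 ≤ (sonin α n).eval x := by
  rw [eval_sonin]
  have h : 0 ≤ 1 - x ^ 2 := by nlinarith [hx.1, hx.2]
  have := mul_nonneg h (sq_nonneg ((derivative (gegenbauer α n)).eval x))
  linarith

theorem abs_mem_Icc {x : ℝ} (hx : x ∈ Set.Icc (-1 : ℝ) 1) : |x| ∈ Set.Icc (0 : ℝ) 1 :=
  ⟨abs_nonneg x, abs_le.2 hx⟩

theorem abs_eval_gegenbauer_le_one (hα : 0 ≤ α) (n : ℕ) {x : ℝ} (hx : x ∈ Set.Icc (-1 : ℝ) 1) :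
    |(gegenbauer α n).eval x| ≤ 1 := by
  -- For `n = 0` the coefficient `n (n + 2α)` vanishes and the Sonin function says nothing.
  rcases n.eq_zero_or_pos with rfl | hn
  · simp [gegenbauer_zero]
  have hα' : -1 / 2 < α := by linarith
  have hn0 : (0 : ℝ) < n := by exact_mod_cast hn
  rw [← abs_eval_gegenbauer_abs hα', ← sq_le_one_iff_abs_le_one]
  have hx' := abs_mem_Icc hx
  have h1 := mul_eval_gegenbauer_sq_le_sonin (α := α) n hx'
  have h2 := sonin_monotoneOn hα n hx' (Set.right_mem_Icc.2 zero_le_one) hx'.2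
  have h3 := h1.trans h2
  simp only [eval_sonin, eval_one_gegenbauer hα'] at h3
  have hN : 0 < (n : ℝ) * (n + 2 * α) := by positivity
  refine le_of_mul_le_mul_left ?_ hN
  linarith

theorem eval_zero_gegenbauer (hα : -1 / 2 < α) (m : ℕ) :
    (gegenbauer α (2 * m + 1)).eval 0 = 0 ∧
      |(gegenbauer α (2 * m)).eval 0| = Real.Gamma (α + 1 / 2) / Real.Gamma (1 / 2) *
        (Real.Gamma (m + 1 / 2) / Real.Gamma (m + (α + 1 / 2))) := by
  induction m with
  | zero =>
    have h1 := (Real.Gamma_pos_of_pos (show 0 < α + 1 / 2 by linarith)).ne'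
    have h2 := (Real.Gamma_pos_of_pos (show (0 : ℝ) < 1 / 2 by norm_num)).ne'
    simp only [Nat.mul_zero, zero_add, gegenbauer_one, gegenbauer_zero, eval_X, eval_one, abs_one,
      Nat.cast_zero, true_and]
    rw [div_mul_div_cancel₀ h2, div_self h1]
  | succ m ih =>
    have hm : (0 : ℝ) ≤ m := m.cast_nonneg
    have r1 := eval_gegenbauer_rec hα (2 * m) 0
    have r2 := eval_gegenbauer_rec hα (2 * m + 1) 0
    have p1 := succ_add_two_mul_pos hα (2 * m)
    have p2 := succ_add_two_mul_pos hα (2 * m + 1)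
    rw [show 2 * m + 1 + 2 = 2 * (m + 1) + 1 by ring, ih.1] at r2
    constructor
    · have : (((2 * m + 1 : ℕ) : ℝ) + 1 + 2 * α) * (gegenbauer α (2 * (m + 1) + 1)).eval 0 = 0 := by
        rw [r2]; ring
      exact (mul_eq_zero.1 this).resolve_left p2.ne'
    · rw [show 2 * m + 2 = 2 * (m + 1) by ring] at r1
      have e : |(gegenbauer α (2 * (m + 1))).eval 0| =
          (m + 1 / 2) / (m + (α + 1 / 2)) * |(gegenbauer α (2 * m)).eval 0| := by
        have h := congrArg abs r1
        push_cast at p1 h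
        rw [mul_zero, zero_mul, zero_sub, abs_neg, abs_mul, abs_mul, abs_of_pos p1,
          abs_of_pos (show 0 < 2 * (m : ℝ) + 1 by positivity)] at h
        have h3 : 0 < (m : ℝ) + (α + 1 / 2) := by linarith
        rw [div_mul_eq_mul_div, eq_div_iff h3.ne']
        linarith
      have h3 : 0 < (m : ℝ) + (α + 1 / 2) := by linarith
      rw [e, ih.2, Nat.cast_add_one, show (m : ℝ) + 1 + 1 / 2 = m + 1 / 2 + 1 by ring,
        show (m : ℝ) + 1 + (α + 1 / 2) = m + (α + 1 / 2) + 1 by ring,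
        Real.Gamma_add_one (by positivity), Real.Gamma_add_one h3.ne', mul_div_mul_comm]
      ring

theorem exists_abs_eval_zero_gegenbauer_le (hα : -1 / 2 < α) (hα0 : α < 0) :
    ∃ D : ℝ, 0 < D ∧ ∀ m n : ℕ, m ≤ n → 1 ≤ n →
      |(gegenbauer α (2 * m)).eval 0| ≤ D * (n : ℝ) ^ (-α) := by
  have hs : 0 < α + 1 / 2 := by linarith
  obtain ⟨D, hD, h⟩ := exists_Gamma_add_le (s := 1 / 2) (t := α + 1 / 2) (by norm_num) hs
  have h1 := Real.Gamma_pos_of_pos hs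
  have h2 := Real.Gamma_pos_of_pos (show (0 : ℝ) < 1 / 2 by norm_num)
  set E := Real.Gamma (α + 1 / 2) / Real.Gamma (1 / 2) with hE
  have hE0 : 0 < E := by positivity
  -- The `+ 1` covers `m = 0`, where the Gamma estimate does not apply.
  refine ⟨E * D + 1, by positivity, fun m n hmn hn => ?_⟩
  have hn1 : (1 : ℝ) ≤ n := by exact_mod_cast hn
  have hpow : 1 ≤ (n : ℝ) ^ (-α) := Real.one_le_rpow hn1 (by linarith)
  rcases m.eq_zero_or_pos with rfl | hm
  · rw [Nat.mul_zero, gegenbauer_zero, eval_one, abs_one]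
    have : 0 ≤ E * D := by positivity
    nlinarith
  · have hG := Real.Gamma_pos_of_pos (show 0 < (m : ℝ) + (α + 1 / 2) by positivity)
    have hmn' : (m : ℝ) ^ (-α) ≤ (n : ℝ) ^ (-α) :=
      Real.rpow_le_rpow m.cast_nonneg (by exact_mod_cast hmn) (by linarith)
    rw [(eval_zero_gegenbauer hα m).2]
    have h3 : Real.Gamma (m + 1 / 2) / Real.Gamma (m + (α + 1 / 2)) ≤ D * (n : ℝ) ^ (-α) := by
      rw [div_le_iff₀ hG]
      have h4 := h m hm
      rw [show 1 / 2 - (α + 1 / 2) = -α by ring] at h4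
      exact h4.trans (by gcongr)
    have h5 := mul_le_mul_of_nonneg_left h3 hE0.le
    linarith

/-- The Sonin function is largest at `0`, where `G_n' = n G_{n-1}`. By parity only one of `G_n(0)`
and `G_{n-1}(0)` survives, always one of even degree. -/
theorem exists_abs_eval_gegenbauer_le (hα : -1 / 2 < α) (hα0 : α < 0) :
    ∃ D : ℝ, 0 < D ∧ ∀ n : ℕ, 1 ≤ n → ∀ x ∈ Set.Icc (-1 : ℝ) 1,
      |(gegenbauer α n).eval x| ≤ D * (n : ℝ) ^ (-α) := by
  obtain ⟨D, hD, h⟩ := exists_abs_eval_zero_gegenbauer_le hα hα0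
  have hK : 0 < 1 + 2 * α := by linarith
  refine ⟨D / √(1 + 2 * α), by positivity, fun n hn x hx => ?_⟩
  have hn1 : (1 : ℝ) ≤ n := by exact_mod_cast hn
  have hN : 0 < (n : ℝ) * (n + 2 * α) := mul_pos (by linarith) (by linarith)
  have hx' := abs_mem_Icc hx
  rw [← abs_eval_gegenbauer_abs hα]
  have h1 := (mul_eval_gegenbauer_sq_le_sonin (α := α) n hx').trans
    (sonin_antitoneOn hα hα0 n (Set.left_mem_Icc.2 zero_le_one) hx' hx'.1)
  simp only [eval_sonin] at h1
  have key : (1 + 2 * α) * (gegenbauer α n).eval |x| ^ 2 ≤ (D * (n : ℝ) ^ (-α)) ^ 2 := by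
    have hder := congrArg (eval 0) (one_sub_sq_mul_derivative_succ hα (n - 1))
    rw [Nat.sub_add_cancel hn] at hder
    simp only [eval_mul, eval_sub, eval_one, eval_pow, eval_X, eval_C] at hder
    have hcast : ((n - 1 : ℕ) : ℝ) + 1 = n := by rw [Nat.cast_sub hn]; simp
    rw [hcast] at hder
    have hd : (derivative (gegenbauer α n)).eval 0 = n * (gegenbauer α (n - 1)).eval 0 := by
      linarith
    rw [hd] at h1
    rcases n.even_or_odd' with ⟨m, hm | hm⟩
    · have hz : (gegenbauer α (n - 1)).eval 0 = 0 := by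
        rw [show n - 1 = 2 * (m - 1) + 1 by omega]
        exact (eval_zero_gegenbauer hα _).1
      have h0 := h m n (by omega) hn
      rw [← hm] at h0
      have h2 : (gegenbauer α n).eval |x| ^ 2 ≤ (gegenbauer α n).eval 0 ^ 2 := by
        refine le_of_mul_le_mul_left (h1.trans_eq ?_) hN
        rw [hz]; ring
      have h3 := pow_le_pow_left₀ (abs_nonneg _) h0 2
      rw [sq_abs] at h3
      nlinarith [sq_nonneg ((gegenbauer α n).eval |x|)]
    · have hz : (gegenbauer α n).eval 0 = 0 := by
        rw [hm]
        exact (eval_zero_gegenbauer hα _).1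
      have h0 := h m n (by omega) hn
      rw [show 2 * m = n - 1 by omega] at h0
      have h3 := pow_le_pow_left₀ (abs_nonneg _) h0 2
      rw [sq_abs] at h3
      rw [hz] at h1
      have h4 : (n : ℝ) * ((n + 2 * α) * (gegenbauer α n).eval |x| ^ 2) ≤
          n * (n * (gegenbauer α (n - 1)).eval 0 ^ 2) := by
        refine (le_of_eq_of_le ?_ h1).trans_eq ?_ <;> ring
      have h5 := le_of_mul_le_mul_left h4 (by linarith)
      -- Since `α < 0` and `n ≥ 1`, `n + 2α ≥ n (1 + 2α)`; this is the source of `√(1 + 2α)` in the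
      -- constant.
      have h6 : (n : ℝ) * ((1 + 2 * α) * (gegenbauer α n).eval |x| ^ 2) ≤
          n * (gegenbauer α (n - 1)).eval 0 ^ 2 := by
        refine le_trans ?_ h5
        nlinarith [mul_nonneg (mul_nonneg (sub_nonneg.2 hn1) (neg_nonneg.2 hα0.le))
          (sq_nonneg ((gegenbauer α n).eval |x|))]
      exact (le_of_mul_le_mul_left h6 (by linarith)).trans h3
  rw [div_mul_eq_mul_div, le_div_iff₀ (Real.sqrt_pos.2 hK)]
  refine abs_le_of_sq_le_sq' ?_ (by positivity) |>.2
  rw [mul_pow, sq_abs, Real.sq_sqrt hK.le]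
  linarith

theorem exists_abs_eval_radauPoly_le (hα : -1 / 2 < α) (hα0 : α < 0) :
    ∃ D : ℝ, 0 < D ∧ ∀ n : ℕ, 1 ≤ n → ∀ x ∈ Set.Icc (-1 : ℝ) 1,
      |(radauPoly α n).eval x| ≤ D * (n : ℝ) ^ (-α) := by
  obtain ⟨D, hD, h⟩ := exists_abs_eval_gegenbauer_le hα hα0
  refine ⟨D * 2 ^ (-α) + D, by positivity, fun n hn x hx => ?_⟩
  have hn1 : (1 : ℝ) ≤ n := by exact_mod_cast hn
  have h1 := h (n + 1) (by omega) x hx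
  have h2 := h n hn x hx
  have h3 : ((n + 1 : ℕ) : ℝ) ^ (-α) ≤ 2 ^ (-α) * (n : ℝ) ^ (-α) := by
    rw [← Real.mul_rpow two_pos.le (by linarith)]
    refine Real.rpow_le_rpow (by positivity) ?_ (by linarith)
    push_cast
    linarith
  have h4 := mul_le_mul_of_nonneg_left h3 hD.le
  rw [radauPoly, eval_sub]
  have h5 := abs_sub ((gegenbauer α (n + 1)).eval x) ((gegenbauer α n).eval x)
  linarith

theorem abs_eval_radauPoly_le_two (hα : 0 ≤ α) (n : ℕ) {x : ℝ} (hx : x ∈ Set.Icc (-1 : ℝ) 1) :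
    |(radauPoly α n).eval x| ≤ 2 := by
  have h1 := abs_eval_gegenbauer_le_one hα (n + 1) hx
  have h2 := abs_eval_gegenbauer_le_one hα n hx
  rw [radauPoly, eval_sub]
  have h5 := abs_sub ((gegenbauer α (n + 1)).eval x) ((gegenbauer α n).eval x)
  linarith

/-! ### The truncation error of the shifted quadrature -/

theorem intMatrix_apply (n : ℕ) (i k : Fin (n + 1)) :
    intMatrix α n i k =
      weight α n k * ∫ x in (-1 : ℝ)..(node α n i), (kernelPoly α n (node α n k)).eval x := by
  simp only [eval_kernelPoly]
  rw [intervalIntegral.integral_finsetSum, Finset.mul_sum, intMatrix, Matrix.of_apply]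
  · refine Finset.sum_congr rfl fun j _ => ?_
    rw [intervalIntegral.integral_const_mul]
    ring
  · intro j _
    exact (continuous_const.mul (gegenbauer α j).continuous).intervalIntegrable _ _

/-- The affine polynomial mapping `[0, b]` onto `[-1, 1]`. -/
def affinePoly (b : ℝ) : ℝ[X] := C (2 / b) * X + C (-1)

theorem eval_affinePoly (b x : ℝ) : (affinePoly b).eval x = 2 / b * x - 1 := by
  simp [affinePoly, sub_eq_add_neg]

theorem two_div_mul_shiftedNode_sub_one {b : ℝ} (hb : 0 < b) (n k : ℕ) :
    2 / b * shiftedNode α b n k - 1 = node α n k := by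
  rw [shiftedNode]
  field_simp
  ring

/-- The polynomial interpolating `f` at the shifted nodes. -/
def interpPoly (α b : ℝ) (n : ℕ) (f : ℝ → ℝ) : ℝ[X] :=
  ∑ k : Fin (n + 1), C (weight α n k * f (shiftedNode α b n k)) *
    (kernelPoly α n (node α n k)).comp (affinePoly b)

theorem eval_interpPoly (b : ℝ) (n : ℕ) (f : ℝ → ℝ) (x : ℝ) :
    (interpPoly α b n f).eval x = ∑ k : Fin (n + 1), weight α n k * f (shiftedNode α b n k) *
      (kernelPoly α n (node α n k)).eval (2 / b * x - 1) := by
  simp [interpPoly, eval_finsetSum, eval_affinePoly]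

/-- Each matrix entry is the integral of a Lagrange basis polynomial; the affine substitution
produces the factor `b / 2`. -/
theorem integral_interpPoly {b : ℝ} (hb : 0 < b) (n : ℕ) (f : ℝ → ℝ) (i : Fin (n + 1)) :
    ∫ x in (0 : ℝ)..(shiftedNode α b n i), (interpPoly α b n f).eval x =
      ∑ k : Fin (n + 1), shiftedIntMatrix α b n i k * f (shiftedNode α b n k) := by
  simp only [eval_interpPoly]
  rw [intervalIntegral.integral_finsetSum]
  · refine Finset.sum_congr rfl fun k _ => ?_
    rw [intervalIntegral.integral_const_mul,
      intervalIntegral.integral_comp_mul_sub (fun x => (kernelPoly α n (node α n k)).eval x)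
        (by positivity), two_div_mul_shiftedNode_sub_one hb, shiftedIntMatrix, Matrix.smul_apply,
      intMatrix_apply, mul_zero, zero_sub, inv_div, smul_eq_mul, smul_eq_mul]
    ring
  · intro k _
    refine (Continuous.mul continuous_const ?_).intervalIntegrable _ _
    exact (kernelPoly α n (node α n k)).continuous.comp (by fun_prop)

theorem eval_interpPoly_shiftedNode (hα : -1 / 2 < α) {b : ℝ} (hb : 0 < b) (n : ℕ) (f : ℝ → ℝ)
    (i : Fin (n + 1)) :
    (interpPoly α b n f).eval (shiftedNode α b n i) = f (shiftedNode α b n i) := by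
  rw [eval_interpPoly, two_div_mul_shiftedNode_sub_one hb,
    Finset.sum_eq_single_of_mem i (Finset.mem_univ i)]
  · rw [mul_right_comm, weight_mul_eval_kernelPoly hα, if_pos rfl, one_mul]
  · intro k _ hk
    rw [mul_right_comm, weight_mul_eval_kernelPoly hα, if_neg hk, zero_mul]

theorem natDegree_affinePoly {b : ℝ} (hb : 0 < b) : (affinePoly b).natDegree = 1 :=
  natDegree_linear (by positivity)

theorem natDegree_interpPoly_le {b : ℝ} (hb : 0 < b) (n : ℕ) (f : ℝ → ℝ) :
    (interpPoly α b n f).natDegree ≤ n := by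
  refine natDegree_sum_le_of_forall_le _ _ fun k _ => ?_
  refine (natDegree_C_mul_le _ _).trans ?_
  rw [natDegree_comp, natDegree_affinePoly hb, mul_one]
  exact natDegree_kernelPoly_le _ _

theorem shiftedNode_mem (hα : -1 / 2 < α) {b : ℝ} (hb : 0 < b) {n k : ℕ} (hk : k < n + 1) :
    shiftedNode α b n k ∈ Set.Icc 0 b := by
  have h1 := neg_one_lt_node hα hk
  have h2 := node_le_one hα hk
  rw [shiftedNode]
  constructor
  · exact mul_nonneg (by positivity) (by linarith)
  · nlinarith

theorem eval_comp_affinePoly (b : ℝ) (n : ℕ) (x : ℝ) :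
    ((radauPoly α n).comp (affinePoly b)).eval x = shiftedRadau α b n x := by
  rw [eval_comp, eval_affinePoly, shiftedRadau, div_mul_eq_mul_div]

theorem leadingCoeff_comp_affinePoly (hα : -1 / 2 < α) {b : ℝ} (hb : 0 < b) (n : ℕ) :
    ((radauPoly α n).comp (affinePoly b)).leadingCoeff = shiftedLeadCoeff α b (n + 1) := by
  rw [leadingCoeff_comp (by rw [natDegree_affinePoly hb]; exact one_ne_zero),
    leadingCoeff_radauPoly hα, natDegree_radauPoly hα, affinePoly,
    leadingCoeff_linear (by positivity), shiftedLeadCoeff, mul_comm]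

theorem abs_sub_eval_interpPoly_le (hα : -1 / 2 < α) {b : ℝ} (hb : 0 < b) {n : ℕ} {f : ℝ → ℝ}
    (hf : ContDiffOn ℝ ((n + 1 : ℕ) : WithTop ℕ∞) f (Set.Icc 0 b)) {A : ℝ}
    (hA : ∀ x ∈ Set.Icc 0 b, |iteratedDerivWithin (n + 1) f (Set.Icc 0 b) x| ≤ A) {x : ℝ}
    (hx : x ∈ Set.Icc 0 b) :
    |f x - (interpPoly α b n f).eval x| ≤
      A / ((n + 1).factorial * |shiftedLeadCoeff α b (n + 1)|) * |shiftedRadau α b n x| := by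
  rw [← leadingCoeff_comp_affinePoly hα hb, ← eval_comp_affinePoly]
  have hinj : Function.Injective fun k : Fin (n + 1) => shiftedNode α b n k := by
    intro i k hik
    have h := congrArg (fun t => 2 / b * t - 1) hik
    simp only [two_div_mul_shiftedNode_sub_one hb, node_inj hα i.2 k.2] at h
    exact Fin.ext h
  refine abs_sub_interpolation_le hb hf hA (natDegree_interpPoly_le hb n f) ?_
    (s := Finset.univ.image fun k : Fin (n + 1) => shiftedNode α b n k) ?_ ?_ ?_ ?_ hx
  · rw [natDegree_comp, natDegree_affinePoly hb, natDegree_radauPoly hα, mul_one]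
  · rw [Finset.card_image_of_injective _ hinj, Finset.card_univ, Fintype.card_fin]
  all_goals
    intro y hy
    obtain ⟨k, -, rfl⟩ := Finset.mem_image.1 hy
  · exact shiftedNode_mem hα hb k.2
  · rw [eval_comp, eval_affinePoly, two_div_mul_shiftedNode_sub_one hb, eval_node hα k.2]
  · exact (eval_interpPoly_shiftedNode hα hb n f k).symm

theorem shiftedLeadCoeff_pos (hα : -1 / 2 < α) {b : ℝ} (hb : 0 < b) (n : ℕ) :
    0 < shiftedLeadCoeff α b (n + 1) :=
  mul_pos (by positivity) (leadCoeff_succ_pos hα n)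

theorem abs_integral_le_of_forall_Icc {g : ℝ → ℝ} {b y M : ℝ} (hy : y ∈ Set.Icc 0 b)
    (hM : ∀ x ∈ Set.Icc 0 b, |g x| ≤ M) : |∫ x in (0 : ℝ)..y, g x| ≤ M * y := by
  have h := intervalIntegral.norm_integral_le_of_norm_le_const (a := 0) (b := y) (f := g) (C := M)
    fun x hx => by
      rw [Set.uIoc_of_le hy.1] at hx
      exact hM x ⟨hx.1.le, hx.2.trans hy.2⟩
  rwa [sub_zero, abs_of_nonneg hy.1] at h

theorem abs_truncError_le (hα : -1 / 2 < α) {b : ℝ} (hb : 0 < b) {n : ℕ} {f : ℝ → ℝ}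
    (hf : ContDiffOn ℝ ((n + 1 : ℕ) : WithTop ℕ∞) f (Set.Icc 0 b)) {A M : ℝ}
    (hA : ∀ x ∈ Set.Icc 0 b, |iteratedDerivWithin (n + 1) f (Set.Icc 0 b) x| ≤ A)
    (hM : ∀ x ∈ Set.Icc 0 b, |shiftedRadau α b n x| ≤ M) (i : Fin (n + 1)) :
    |truncError α b n f i| ≤
      A / ((n + 1).factorial * shiftedLeadCoeff α b (n + 1)) * M * shiftedNode α b n i := by
  have hA0 : 0 ≤ A := (abs_nonneg _).trans (hA 0 (Set.left_mem_Icc.2 hb.le))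
  have hK := shiftedLeadCoeff_pos hα hb n
  have hi := shiftedNode_mem hα hb i.2
  have hfi : IntervalIntegrable f MeasureTheory.volume 0 (shiftedNode α b n i) := by
    refine (hf.continuousOn.mono ?_).intervalIntegrable
    rw [Set.uIcc_of_le hi.1]
    exact Set.Icc_subset_Icc le_rfl hi.2
  rw [truncError, ← integral_interpPoly hb, ← intervalIntegral.integral_sub hfi
    ((interpPoly α b n f).continuous.intervalIntegrable _ _)]
  refine abs_integral_le_of_forall_Icc hi fun x hx => ?_
  have h := abs_sub_eval_interpPoly_le hα hb hf hA hx
  rw [abs_of_pos hK] at h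
  exact h.trans (mul_le_mul_of_nonneg_left (hM x hx) (by positivity))

theorem abs_errorTerm_le (hα : -1 / 2 < α) {b : ℝ} (hb : 0 < b) {n : ℕ} {f : ℝ → ℝ} {A M : ℝ}
    (hA : ∀ x ∈ Set.Icc 0 b, |iteratedDerivWithin (n + 1) f (Set.Icc 0 b) x| ≤ A)
    (hM : ∀ x ∈ Set.Icc 0 b, |shiftedRadau α b n x| ≤ M) (i : Fin (n + 1)) {ξ : ℝ}
    (hξ : ξ ∈ Set.Ioo 0 b) :
    |errorTerm α b n f i ξ| ≤
      A / ((n + 1).factorial * shiftedLeadCoeff α b (n + 1)) * M * shiftedNode α b n i := by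
  have hA0 : 0 ≤ A := (abs_nonneg _).trans (hA 0 (Set.left_mem_Icc.2 hb.le))
  have hK := shiftedLeadCoeff_pos hα hb n
  have hd : 0 < ((n + 1).factorial : ℝ) * shiftedLeadCoeff α b (n + 1) :=
    mul_pos (by exact_mod_cast (n + 1).factorial_pos) hK
  rw [errorTerm, abs_mul, abs_div, abs_of_pos hd, mul_assoc]
  exact mul_le_mul (div_le_div_of_nonneg_right (hA ξ (Set.Ioo_subset_Icc_self hξ)) hd.le)
    (abs_integral_le_of_forall_Icc (shiftedNode_mem hα hb i.2) hM) (abs_nonneg _) (by positivity)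

theorem div_shiftedLeadCoeff_mul_eq (hα : -1 / 2 < α) {b : ℝ} (hb : 0 < b) (n : ℕ)
    (A M x : ℝ) :
    A / ((n + 1).factorial * shiftedLeadCoeff α b (n + 1)) * M * x =
      (2 : ℝ) ^ (-2 * (n : ℤ) - 1) * A * b ^ (n + 1) * x *
          Real.Gamma ((n : ℝ) + 2 * α + 1) * Real.Gamma (α + 1) /
        (((n + 1).factorial : ℝ) * Real.Gamma ((n : ℝ) + α + 1) * Real.Gamma (2 * α + 1)) * M := by
  have hp := succ_add_two_mul_pos hα n
  have hq := succ_add_pos hα n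
  have h1 := (Real.Gamma_pos_of_pos (show 0 < α + 1 by linarith)).ne'
  have h2 := (Real.Gamma_pos_of_pos (show 0 < 2 * α + 1 by linarith)).ne'
  have h3 := (Real.Gamma_pos_of_pos (show 0 < n + 2 * α + 1 by linarith)).ne'
  have h4 := (Real.Gamma_pos_of_pos (show 0 < n + α + 1 by linarith)).ne'
  have hf : ((n + 1).factorial : ℝ) ≠ 0 := by exact_mod_cast (n + 1).factorial_ne_zero
  have e : (2 : ℝ) ^ (-2 * (n : ℤ) - 1) = (2 ^ (n + 1) * 2 ^ n)⁻¹ := by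
    rw [show -2 * (n : ℤ) - 1 = -((n + 1 + n : ℕ) : ℤ) by push_cast; ring, zpow_neg,
      zpow_natCast, pow_add]
  rw [e, shiftedLeadCoeff, leadCoeff_succ hα, div_pow]
  generalize Real.Gamma (α + 1) = a1 at *
  generalize Real.Gamma (2 * α + 1) = a2 at *
  generalize Real.Gamma (n + 2 * α + 1) = a3 at *
  generalize Real.Gamma (n + α + 1) = a4 at *
  field_simp

/-- Keeping `M` free lets all three regimes use the same estimate: `M` is the sup norm in (a), `2`
in (b) and a multiple of `n^(-α)` in (c). -/
theorem errors_le (hα : -1 / 2 < α) {b : ℝ} (hb : 0 < b) {n : ℕ} {f : ℝ → ℝ}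
    (hf : ContDiffOn ℝ ((n + 1 : ℕ) : WithTop ℕ∞) f (Set.Icc 0 b)) {A M : ℝ}
    (hA : supNormOn (iteratedDerivWithin (n + 1) f (Set.Icc 0 b)) (Set.Icc 0 b) = A)
    (hM : ∀ x ∈ Set.Icc 0 b, |shiftedRadau α b n x| ≤ M) (i : Fin (n + 1)) {T : ℝ}
    (hT : (2 : ℝ) ^ (-2 * (n : ℤ) - 1) * A * b ^ (n + 1) * shiftedNode α b n i *
          Real.Gamma ((n : ℝ) + 2 * α + 1) * Real.Gamma (α + 1) /
        (((n + 1).factorial : ℝ) * Real.Gamma ((n : ℝ) + α + 1) * Real.Gamma (2 * α + 1)) * M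
        ≤ T) :
    |truncError α b n f i| ≤ T ∧ ∀ ξ ∈ Set.Ioo 0 b, |errorTerm α b n f i ξ| ≤ T := by
  have hA' : ∀ x ∈ Set.Icc 0 b, |iteratedDerivWithin (n + 1) f (Set.Icc 0 b) x| ≤ A := by
    intro x hx
    rw [← hA]
    -- `sSup` bounds the values only once boundedness is known; here it comes from compactness.
    refine le_csSup ?_ (Set.mem_image_of_mem _ hx)
    exact (isCompact_Icc.image_of_continuousOn
      (hf.continuousOn_iteratedDerivWithin le_rfl (uniqueDiffOn_Icc hb)).abs).bddAbove
  rw [← div_shiftedLeadCoeff_mul_eq hα hb] at hT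
  exact ⟨(abs_truncError_le hα hb hf hA' hM i).trans hT,
    fun ξ hξ => (abs_errorTerm_le hα hb hA' hM i hξ).trans hT⟩

theorem supNormOn_nonneg (g : ℝ → ℝ) (S : Set ℝ) : 0 ≤ supNormOn g S :=
  Real.sSup_nonneg fun _ ⟨_, _, h⟩ => h ▸ abs_nonneg _

theorem abs_shiftedRadau_le_supNormOn (b : ℝ) (n : ℕ) {x : ℝ} (hx : x ∈ Set.Icc 0 b) :
    |shiftedRadau α b n x| ≤ supNormOn (shiftedRadau α b n) (Set.Icc 0 b) := by
  have hc : Continuous (shiftedRadau α b n) :=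
    (radauPoly α n).continuous.comp (by fun_prop)
  exact le_csSup (isCompact_Icc.image_of_continuousOn hc.abs.continuousOn).bddAbove
    (Set.mem_image_of_mem _ hx)

theorem two_mul_div_sub_one_mem {b : ℝ} (hb : 0 < b) {x : ℝ} (hx : x ∈ Set.Icc 0 b) :
    2 * x / b - 1 ∈ Set.Icc (-1 : ℝ) 1 := by
  have h1 : 0 ≤ 2 * x / b := div_nonneg (by linarith [hx.1]) hb.le
  have h2 : 2 * x / b ≤ 2 := by
    rw [div_le_iff₀ hb]
    linarith [hx.2]
  constructor <;> linarith

theorem exists_Gamma_quotient_le (hα : -1 / 2 < α) :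
    ∃ D : ℝ, 0 < D ∧ ∀ n : ℕ, 1 ≤ n →
      Real.Gamma ((n : ℝ) + 2 * α + 1) * Real.Gamma (α + 1) /
        (((n + 1).factorial : ℝ) * Real.Gamma ((n : ℝ) + α + 1) * Real.Gamma (2 * α + 1)) ≤
      D * Real.exp 1 ^ n * (n : ℝ) ^ α * (n : ℝ) ^ (-((n : ℝ) + 3 / 2)) := by
  have ha1 : 0 < α + 1 := by linarith
  have ha2 : 0 < 2 * α + 1 := by linarith
  obtain ⟨D, hD, h⟩ := exists_Gamma_add_le ha2 ha1
  have h1 := Real.Gamma_pos_of_pos ha1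
  have h2 := Real.Gamma_pos_of_pos ha2
  refine ⟨D * (Real.Gamma (α + 1) / Real.Gamma (2 * α + 1)), by positivity, fun n hn => ?_⟩
  have hn0 : (0 : ℝ) < n := by exact_mod_cast hn
  have hG := h n hn
  rw [show 2 * α + 1 - (α + 1) = α by ring, ← add_assoc, ← add_assoc] at hG
  have h3 := Real.Gamma_pos_of_pos (show 0 < (n : ℝ) + α + 1 by linarith)
  have hS := rpow_mul_exp_le_factorial_succ hn
  have hf : (0 : ℝ) < (n + 1).factorial := by exact_mod_cast (n + 1).factorial_pos
  have hpow : 0 < (n : ℝ) ^ ((n : ℝ) + 3 / 2) := Real.rpow_pos_of_pos hn0 _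
  have hS' : (((n + 1).factorial : ℕ) : ℝ)⁻¹ ≤
      Real.exp 1 ^ n * (n : ℝ) ^ (-((n : ℝ) + 3 / 2)) := by
    rw [Real.rpow_neg hn0.le, ← div_eq_mul_inv, inv_eq_one_div, div_le_div_iff₀ hf hpow, one_mul]
    exact hS
  have hG' : Real.Gamma (n + 2 * α + 1) / Real.Gamma (n + α + 1) ≤ D * (n : ℝ) ^ α :=
    (div_le_iff₀ h3).2 hG
  calc _ = Real.Gamma (n + 2 * α + 1) / Real.Gamma (n + α + 1) * (((n + 1).factorial : ℕ) : ℝ)⁻¹ *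
        (Real.Gamma (α + 1) / Real.Gamma (2 * α + 1)) := by
          generalize Real.Gamma (n + 2 * α + 1) = u
          field_simp
    _ ≤ D * (n : ℝ) ^ α * (Real.exp 1 ^ n * (n : ℝ) ^ (-((n : ℝ) + 3 / 2))) *
        (Real.Gamma (α + 1) / Real.Gamma (2 * α + 1)) := by gcongr
    _ = _ := by ring

end GegenbauerRadau

end

open GegenbauerRadau

theorem theorem7 (α : ℝ) (hα : -1 / 2 < α) :
    (∀ (n : ℕ) (b : ℝ) (f : ℝ → ℝ) (A : ℝ), 0 < b →
      ContDiffOn ℝ ((n + 1 : ℕ) : WithTop ℕ∞) f (Set.Icc 0 b) →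
      GegenbauerRadau.supNormOn
        (iteratedDerivWithin (n + 1) f (Set.Icc 0 b)) (Set.Icc 0 b) = A →
      ∀ i : Fin (n + 1),
        |GegenbauerRadau.truncError α b n f i| ≤
          (2 : ℝ) ^ (-2 * (n : ℤ) - 1) * A * b ^ (n + 1) *
              GegenbauerRadau.shiftedNode α b n i *
              Real.Gamma ((n : ℝ) + 2 * α + 1) * Real.Gamma (α + 1) /
            (((n + 1).factorial : ℝ) * Real.Gamma ((n : ℝ) + α + 1) *
              Real.Gamma (2 * α + 1)) *
            GegenbauerRadau.supNormOn (GegenbauerRadau.shiftedRadau α b n) (Set.Icc 0 b) ∧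
        ∀ ξ ∈ Set.Ioo 0 b, |GegenbauerRadau.errorTerm α b n f i ξ| ≤
          (2 : ℝ) ^ (-2 * (n : ℤ) - 1) * A * b ^ (n + 1) *
              GegenbauerRadau.shiftedNode α b n i *
              Real.Gamma ((n : ℝ) + 2 * α + 1) * Real.Gamma (α + 1) /
            (((n + 1).factorial : ℝ) * Real.Gamma ((n : ℝ) + α + 1) *
              Real.Gamma (2 * α + 1)) *
            GegenbauerRadau.supNormOn (GegenbauerRadau.shiftedRadau α b n) (Set.Icc 0 b)) ∧
    (0 ≤ α → ∃ B : ℝ, 0 < B ∧ ∃ N : ℕ, ∀ n : ℕ, N ≤ n → ∀ (b : ℝ) (f : ℝ → ℝ) (A : ℝ), 0 < b →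
      ContDiffOn ℝ ((n + 1 : ℕ) : WithTop ℕ∞) f (Set.Icc 0 b) →
      GegenbauerRadau.supNormOn
        (iteratedDerivWithin (n + 1) f (Set.Icc 0 b)) (Set.Icc 0 b) = A →
      ∀ i : Fin (n + 1),
        |GegenbauerRadau.truncError α b n f i| ≤
          B * A * b ^ (n + 1) * (Real.exp 1 / 4) ^ n *
            (GegenbauerRadau.shiftedNode α b n i / (n : ℝ) ^ ((n : ℝ) + 3 / 2 - α)) ∧
        ∀ ξ ∈ Set.Ioo 0 b, |GegenbauerRadau.errorTerm α b n f i ξ| ≤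
          B * A * b ^ (n + 1) * (Real.exp 1 / 4) ^ n *
            (GegenbauerRadau.shiftedNode α b n i / (n : ℝ) ^ ((n : ℝ) + 3 / 2 - α))) ∧
    (α < 0 → ∃ C : ℝ, 0 < C ∧ ∃ N : ℕ, ∀ n : ℕ, N ≤ n → ∀ (b : ℝ) (f : ℝ → ℝ) (A : ℝ), 0 < b →
      ContDiffOn ℝ ((n + 1 : ℕ) : WithTop ℕ∞) f (Set.Icc 0 b) →
      GegenbauerRadau.supNormOn
        (iteratedDerivWithin (n + 1) f (Set.Icc 0 b)) (Set.Icc 0 b) = A →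
      ∀ i : Fin (n + 1),
        |GegenbauerRadau.truncError α b n f i| ≤
          C * A * (2 : ℝ) ^ (-2 * (n : ℤ) - 1) * Real.exp 1 ^ n *
            (n : ℝ) ^ (-(n : ℝ) - 3 / 2) * GegenbauerRadau.shiftedNode α b n i * b ^ (n + 1) ∧
        ∀ ξ ∈ Set.Ioo 0 b, |GegenbauerRadau.errorTerm α b n f i ξ| ≤
          C * A * (2 : ℝ) ^ (-2 * (n : ℤ) - 1) * Real.exp 1 ^ n *
            (n : ℝ) ^ (-(n : ℝ) - 3 / 2) * GegenbauerRadau.shiftedNode α b n i * b ^ (n + 1)) := by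
  have hquot := exists_Gamma_quotient_le hα
  refine ⟨fun n b f A hb hf hA i => errors_le hα hb hf hA
    (fun x hx => abs_shiftedRadau_le_supNormOn b n hx) i le_rfl, fun hα0 => ?_, fun hα0 => ?_⟩
  · obtain ⟨D, hD, h⟩ := hquot
    refine ⟨D, hD, 1, fun n hn b f A hb hf hA i => errors_le hα hb hf hA
      (fun x hx => abs_eval_radauPoly_le_two hα0 n (two_mul_div_sub_one_mem hb hx)) i ?_⟩
    have hn0 : (0 : ℝ) < n := by exact_mod_cast hn
    have hA0 : 0 ≤ A := hA ▸ supNormOn_nonneg _ _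
    have hi := (shiftedNode_mem hα hb i.2).1
    -- The bound `2` for `|q_n|` absorbs the stray factor `1/2`.
    have e1 : (2 : ℝ) ^ (-2 * (n : ℤ) - 1) * 2 = (4 ^ n)⁻¹ := by
      rw [← zpow_add_one₀ two_ne_zero, show -2 * (n : ℤ) - 1 + 1 = -((2 * n : ℕ) : ℤ) by
        push_cast; ring, zpow_neg, zpow_natCast, pow_mul]
      norm_num
    have e2 : ((n : ℝ) ^ ((n : ℝ) + 3 / 2 - α))⁻¹ =
        (n : ℝ) ^ α * (n : ℝ) ^ (-((n : ℝ) + 3 / 2)) := by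
      rw [← Real.rpow_neg hn0.le, ← Real.rpow_add hn0]
      congr 1
      ring
    have hc : 0 ≤ (4 ^ n)⁻¹ * A * b ^ (n + 1) * shiftedNode α b n i := by positivity
    calc _ = ((2 : ℝ) ^ (-2 * (n : ℤ) - 1) * 2) * A * b ^ (n + 1) * shiftedNode α b n i *
        (Real.Gamma ((n : ℝ) + 2 * α + 1) * Real.Gamma (α + 1) /
          (((n + 1).factorial : ℝ) * Real.Gamma ((n : ℝ) + α + 1) * Real.Gamma (2 * α + 1))) := by
          ring
      _ ≤ _ := mul_le_mul_of_nonneg_left (h n hn) (by rw [e1]; exact hc)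
      _ = _ := by rw [e1, div_eq_mul_inv _ ((n : ℝ) ^ _), e2, div_pow]; ring
  · obtain ⟨D, hD, h⟩ := hquot
    obtain ⟨E, hE, h'⟩ := exists_abs_eval_radauPoly_le hα hα0
    refine ⟨D * E, by positivity, 1, fun n hn b f A hb hf hA i => errors_le hα hb hf hA
      (fun x hx => h' n hn _ (two_mul_div_sub_one_mem hb hx)) i ?_⟩
    have hn0 : (0 : ℝ) < n := by exact_mod_cast hn
    have hA0 : 0 ≤ A := hA ▸ supNormOn_nonneg _ _
    have hi := (shiftedNode_mem hα hb i.2).1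
    -- The growth of `q_n` cancels that of the Gamma quotient, leaving no `α` in the exponent.
    have e1 : (n : ℝ) ^ α * (n : ℝ) ^ (-α) = 1 := by
      rw [← Real.rpow_add hn0, add_neg_cancel, Real.rpow_zero]
    have hc : 0 ≤ (2 : ℝ) ^ (-2 * (n : ℤ) - 1) * A * b ^ (n + 1) * shiftedNode α b n i *
        (E * (n : ℝ) ^ (-α)) := by positivity
    calc _ = (2 : ℝ) ^ (-2 * (n : ℤ) - 1) * A * b ^ (n + 1) * shiftedNode α b n i *
        (E * (n : ℝ) ^ (-α)) *
        (Real.Gamma ((n : ℝ) + 2 * α + 1) * Real.Gamma (α + 1) /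
          (((n + 1).factorial : ℝ) * Real.Gamma ((n : ℝ) + α + 1) * Real.Gamma (2 * α + 1))) := by
          ring
      _ ≤ _ := mul_le_mul_of_nonneg_left (h n hn) hc
      _ = _ := by
          rw [neg_add, ← sub_eq_add_neg]
          linear_combination (D * E * A * (2 : ℝ) ^ (-2 * (n : ℤ) - 1) * Real.exp 1 ^ n *
            (n : ℝ) ^ (-(n : ℝ) - 3 / 2) * shiftedNode α b n i * b ^ (n + 1)) * e1
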